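/- Let $c\ge 1$ be an integer and let $(b_j)_{j\ge 0}$, $(h_j)_{j\ge 1}$ be real sequences with $b_j\ge 0$ $(j\ne 1)$, $0<-b_1=\sum_{j\ne 1}b_j<\infty$, $b_0>0$, $\sum_{j\ge 2}b_j>0$, $h_j\ge 0$ and $h:=\sum_{j\ge1}h_j<\infty$. Let $Q^*=(q^*_{ij})_{i,j\ge 0}$ be the $q$-matrix of the stopped $M^X/M/c$ queue: for $i\ge 1$, $$q^*_{i,i-1}=\min(i,c)\,b_0,\qquad q^*_{ii}=b_1-(\min(i,c)-1)b_0,\qquad q^*_{ij}=b_{j-i+1}\ \ (j\ge i+1),$$ and $q^*_{ij}=0$ otherwise. Let $\tilde Q=Q^*+Q_s$ be the $q$-matrix of the queue with resurrection, where $Q_s$ has row $0$ equal to $(-h,h_1,h_2,\dots)$ and all other rows equal to $0$. For a $q$-matrix $Q$ on $\{0,1,2,\dots\}$, a $Q$-function is a transition function $P(t)=(p_{ij}(t))$, $t\ge 0$ (that is, $p_{ij}(t)\ge 0$, $\sum_j p_{ij}(t)\le 1$, $P(0)=I$, $P(s+t)=P(s)P(t)$), with right derivative $p_{ij}'(0)=q_{ij}$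 for all $i,j$. Put, for $s\in[-1,1]$, $$B(s)=\sum_{j\ge 0}b_js^j,\qquad B_c(s)=B(s)+(c-1)b_0(1-s),\qquad H(s)=\sum_{j\ge 1}h_js^j,\qquad \mu_1=\sum_{j\ge 1}jh_j,$$ and let $B_c'(1)$ be the one-sided derivative of $B_c$ at $1$. Theorem. Assume that $B_c'(1)<0$ and $\mu_1<\infty$. Then $Q^*$- and $\tilde Q$-functions exist, and for any $Q^*$-function $(p^*_{ij}(t))$ and any $\tilde Q$-function $(\tilde p_{ij}(t))$ the following hold. (a) For $i,k\ge 1$ the integral $m^*_k(i):=\int_0^\infty p^*_{ik}(t)\,dt$ is finite, for $k\ge 1$ the series $r_k:=\sum_{i\ge 1}h_i\,m^*_k(i)$ converges, and $$b_0r_1=h,\qquad \sum_{i=1}^{j-1}b_{j-i+1}r_i+\bigl[b_1-(\min(j,c)-1)b_0\bigr]r_j+\min(j+1,c)\,b_0\,r_{j+1}=-h_j\quad(j\ge 1).$$ (b) The queue with resurrection has an equilibrium distribution $(\tilde\pi_j)_{j\ge 0}$, i.e. a probability distribution with $\sum_i\tilde\pi_i\tilde p_{ij}(t)=\tilde\pi_j$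 for all $j$ and $t\ge 0$ and $\lim_{t\to\infty}\tilde p_{ij}(t)=\tilde\pi_j$ for all $i,j$. It is given by $$\tilde\pi_0=-B_c'(1)\Bigl[-B_c'(1)+\mu_1+\sum_{k=1}^{c-1}r_k(c-k)b_0\Bigr]^{-1},\qquad \tilde\pi_k=\tilde\pi_0r_k\quad(k\ge 1),$$ where the bracket is positive. (c) For every $s\in[-1,1)$ one has $B_c(s)\ne 0$, and the generating function $\tilde\Pi(s)=\sum_{j\ge 0}\tilde\pi_js^j$ is $$\tilde\Pi(s)=\tilde\pi_0\Bigl[1+\frac{s(h-H(s))}{B_c(s)}\Bigr]+\frac{1}{B_c(s)}\sum_{k=1}^{c-1}\tilde\pi_ks^k(c-k)b_0(1-s).$$ -/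

import Mathlib

open Set Filter Topology MeasureTheory

namespace MXMc

/-- The standing assumptions on the data of the queue: `c` servers, the rates `b j` (`j ≥ 0`) and
the resurrection rates `h j` (`j ≥ 1`; the value `h 0` is never used). -/
structure IsQueueData (c : ℕ) (b h : ℕ → ℝ) : Prop where
  one_le_c : 1 ≤ c
  b_nonneg : ∀ j, j ≠ 1 → 0 ≤ b j
  b_one_neg : 0 < -b 1
  b_hasSum : HasSum (fun j => if j = 1 then 0 else b j) (-b 1)
  b_zero_pos : 0 < b 0
  b_tail_pos : 0 < ∑' j, b (j + 2)
  h_nonneg : ∀ j, 1 ≤ j → 0 ≤ h j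
  h_summable : Summable fun j => h (j + 1)

/-- The total resurrection rate `h = ∑_{j ≥ 1} h_j`. -/
noncomputable def hTotal (h : ℕ → ℝ) : ℝ := ∑' j, h (j + 1)

/-- The `q`-matrix `Q*` of the queue stopped when it becomes empty. -/
noncomputable def QStar (c : ℕ) (b : ℕ → ℝ) (i j : ℕ) : ℝ :=
  if i = 0 then 0
  else if j + 1 = i then (min i c : ℕ) * b 0
  else if j = i then b 1 - ((min i c : ℕ) - 1) * b 0
  else if i + 1 ≤ j then b (j - i + 1)
  else 0

/-- The `q`-matrix `Q_s` of arrivals into the empty system. -/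
noncomputable def QS (h : ℕ → ℝ) (i j : ℕ) : ℝ :=
  if i = 0 then (if j = 0 then -hTotal h else h j) else 0

/-- The `q`-matrix `Q̃ = Q* + Q_s` of the queue with resurrection. -/
noncomputable def QTilde (c : ℕ) (b h : ℕ → ℝ) (i j : ℕ) : ℝ :=
  QStar c b i j + QS h i j

/-- `P` (restricted to times `t ≥ 0`) is a `Q`-function: a standard transition function on the
state space `ℕ` whose derivative at time `0` is the `q`-matrix `Q`. -/
structure IsQFunction (Q : ℕ → ℕ → ℝ) (P : ℝ → ℕ → ℕ → ℝ) : Prop where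
  nonneg : ∀ t, 0 ≤ t → ∀ i j, 0 ≤ P t i j
  row_summable : ∀ t, 0 ≤ t → ∀ i, Summable (P t i)
  row_le_one : ∀ t, 0 ≤ t → ∀ i, ∑' j, P t i j ≤ 1
  zero : ∀ i j, P 0 i j = if i = j then 1 else 0
  chapman_kolmogorov : ∀ s t, 0 ≤ s → 0 ≤ t → ∀ i j,
    HasSum (fun k => P s i k * P t k j) (P (s + t) i j)
  deriv_zero : ∀ i j, HasDerivWithinAt (fun t => P t i j) (Q i j) (Ici 0) 0

/-- `π` is the equilibrium distribution of the transition function `P`: a stationary probability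
distribution which is also the limit of the transition probabilities from every initial state. -/
structure IsEquilibriumDistribution (P : ℝ → ℕ → ℕ → ℝ) (π : ℕ → ℝ) : Prop where
  nonneg : ∀ j, 0 ≤ π j
  hasSum_one : HasSum π 1
  stationary : ∀ t, 0 ≤ t → ∀ j, HasSum (fun i => π i * P t i j) (π j)
  tendsto : ∀ i j, Tendsto (fun t => P t i j) atTop (𝓝 (π j))

/-- `B(s) = ∑_{j ≥ 0} b_j s^j`, for `s ∈ [-1, 1]`. -/
noncomputable def B (b : ℕ → ℝ) (s : ℝ) : ℝ := ∑' j, b j * s ^ j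

/-- `B_i(s) = B(s) + (i - 1) b_0 (1 - s)`, for `s ∈ [-1, 1]`. -/
noncomputable def Bi (b : ℕ → ℝ) (i : ℕ) (s : ℝ) : ℝ := B b s + ((i : ℝ) - 1) * b 0 * (1 - s)

/-- `B_c'(1)`, the (one-sided) derivative at `1` of the function `B_c` on `[-1, 1]`. It takes the
default value `0` if this derivative does not exist, that is, if it is infinite. -/
noncomputable def BcDerivOne (c : ℕ) (b : ℕ → ℝ) : ℝ := derivWithin (Bi b c) (Icc (-1) 1) 1

/-- `H(s) = ∑_{j ≥ 1} h_j s^j`, for `s ∈ [-1, 1]`. -/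
noncomputable def H (h : ℕ → ℝ) (s : ℝ) : ℝ := ∑' j, h (j + 1) * s ^ (j + 1)

/-- `μ₁ < ∞`, where `μ₁ = ∑_{j ≥ 1} j h_j`. -/
def MuOneFinite (h : ℕ → ℝ) : Prop := Summable fun j : ℕ => ((j : ℝ) + 1) * h (j + 1)

/-- `μ₁ = ∑_{j ≥ 1} j h_j` (meaningful when this sum is finite). -/
noncomputable def muOne (h : ℕ → ℝ) : ℝ := ∑' j : ℕ, ((j : ℝ) + 1) * h (j + 1)

/-- `m*_k(i) = ∫_0^∞ p*_{ik}(t) dt`. -/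
noncomputable def mStar (PStar : ℝ → ℕ → ℕ → ℝ) (k i : ℕ) : ℝ := ∫ t in Ioi (0 : ℝ), PStar t i k

/-- `r_k = ∑_{i ≥ 1} h_i m*_k(i)`. -/
noncomputable def r (h : ℕ → ℝ) (PStar : ℝ → ℕ → ℕ → ℝ) (k : ℕ) : ℝ :=
  ∑' i, h (i + 1) * mStar PStar k (i + 1)

end MXMc

/-! Both q-matrices are conservative with bounded rates, so x ↦ xQ is a bounded operator on ℓ¹ and
exp(tQ) gives a Q-function. Uniformization yields its positivity, and Picard iteration of the
backward equation yields uniqueness. Every claim about arbitrary Q-functions thus becomes a claim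
about exp(tQ) (`IsBoundedQ.eq_semigroup`).

The condition B_c'(1) < 0 enters through a concave function V of linear growth whose drift is at
most B_c'(1) in every state i ≥ 1 (`exists_drift`, for truncations of V). Dynkin's formula bounds
the total time spent in busy states by the stopped queue started at i by V(i)/(-B_c'(1)), so these
times form a vector m_i in ℓ¹. Integrating the forward equation gives m_i Q* = e_0 - e_i
(`gen_occ`). As μ₁ < ∞, the series r = ∑ h_i m_i converges in ℓ¹. The coordinates of r Q* = h e_0 -
∑ h_j e_j are the linear system of (a). Row 0 of Q_s cancels this vector, so w = e_0 + r satisfies w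
Q̃ = 0, and π is w normalized.

Convergence uses neither irreducibility nor an ergodic theorem. Since m_i vanishes at 0, also m_i Q̃
= e_0 - e_i, while the norm of Q̃ exp(tQ̃) is O(t^{-1/2}) (`tendsto_semigroup_gen`). Hence rows 0
and i of exp(tQ̃) merge, and averaging over i against π identifies the limit.

Pairing w Q̃ = 0 with (s^j) gives a functional equation (`tsum_wVec_mul_pow`). Dividing it by B_c(s)
> 0 gives (c); dividing it by 1 - s and letting s ↑ 1 gives the mass of w, hence π_0. -/

namespace MXMc

/-! ### The space ℓ¹ and operators given by their rows -/

/-- The Banach space `ℓ¹` of summable real sequences. -/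
abbrev L1 : Type := lp (fun _ : ℕ => ℝ) 1

/-- The unit vectors of `ℓ¹`. -/
noncomputable abbrev unitVec (i : ℕ) : L1 := lp.single 1 i (1 : ℝ)

lemma unitVec_apply (i j : ℕ) : (unitVec i) j = if i = j then (1 : ℝ) else 0 := by
  rw [lp.single_apply, Pi.single_apply]
  simp only [eq_comm]

lemma L1.hasSum_abs (x : L1) : HasSum (fun i => |x i|) ‖x‖ := by
  have h := lp.hasSum_norm (p := 1) (by simp) x
  simpa using h

lemma L1.summable_abs (x : L1) : Summable fun i => |x i| := x.hasSum_abs.summable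

lemma L1.summable (x : L1) : Summable fun i => x i := x.summable_abs.of_abs

/-- A summable sequence as an element of `ℓ¹`. -/
noncomputable def L1.mk (f : ℕ → ℝ) (hf : Summable fun i => |f i|) : L1 :=
  ⟨f, memℓp_gen (by simpa using hf)⟩

@[simp] lemma L1.mk_apply (f : ℕ → ℝ) (hf : Summable fun i => |f i|) (i : ℕ) :
    (L1.mk f hf) i = f i := rfl

lemma L1.ext' {x y : L1} (h : ∀ i, x i = y i) : x = y := lp.ext (funext h)

section Lift

variable {E : Type*} [NormedAddCommGroup E] [NormedSpace ℝ E]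

/-- The expansion of x in unit vectors converges in norm, so a bounded operator is determined by its
rows. This replaces every interchange of summations below. -/
lemma L1.hasSum_map (S : L1 →L[ℝ] E) (x : L1) : HasSum (fun i => x i • S (unitVec i)) (S x) := by
  have h := (lp.hasSum_single (p := 1) (by simp) x).mapL S
  refine h.congr_fun ?_ 
  intro i
  rw [← map_smul, ← lp.single_smul]
  simp

variable [CompleteSpace E]

/-- The bounded operator on `ℓ¹` with prescribed values on the unit vectors. -/
noncomputable def L1.lift (R : ℕ → E) (C : ℝ) (hR : ∀ i, ‖R i‖ ≤ C) : L1 →L[ℝ] E :=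
  have hs : ∀ x : L1, Summable fun i => ‖x i • R i‖ := fun x =>
    Summable.of_nonneg_of_le (fun _ => norm_nonneg _) (fun i => by
      rw [norm_smul, Real.norm_eq_abs]
      exact mul_le_mul_of_nonneg_left (hR i) (abs_nonneg _)) (x.summable_abs.mul_right C)
  LinearMap.mkContinuous
    { toFun := fun x => ∑' i, x i • R i
      map_add' := fun x y => by
        rw [← (hs x).of_norm.tsum_add (hs y).of_norm]
        simp [add_smul]
      map_smul' := fun a x => by
        rw [RingHom.id_apply, ← (hs x).of_norm.tsum_const_smul]
        simp [mul_smul] } C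
    (fun x => by
      refine tsum_of_norm_bounded (x.hasSum_abs.mul_left C) fun i => ?_
      rw [norm_smul, Real.norm_eq_abs, mul_comm]
      exact mul_le_mul_of_nonneg_right (hR i) (abs_nonneg _))

lemma L1.lift_apply (R : ℕ → E) (C : ℝ) (hR : ∀ i, ‖R i‖ ≤ C) (x : L1) :
    L1.lift R C hR x = ∑' i, x i • R i := rfl

lemma L1.lift_unitVec (R : ℕ → E) (C : ℝ) (hR : ∀ i, ‖R i‖ ≤ C) (i : ℕ) :
    L1.lift R C hR (unitVec i) = R i := by
  rw [L1.lift_apply, tsum_eq_single i]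
  · simp
  · intro j hj
    simp [hj.symm]

lemma L1.hasSum_lift (R : ℕ → E) (C : ℝ) (hR : ∀ i, ‖R i‖ ≤ C) (x : L1) :
    HasSum (fun i => x i • R i) (L1.lift R C hR x) := by
  simpa [L1.lift_unitVec] using L1.hasSum_map (L1.lift R C hR) x

end Lift

/-- Evaluation of a summable sequence at an index. -/
noncomputable abbrev L1.coord (j : ℕ) : L1 →L[ℝ] ℝ := lp.evalCLM (𝕜 := ℝ) (fun _ : ℕ => ℝ) 1 j

lemma L1.coord_apply (j : ℕ) (x : L1) : L1.coord j x = x j := rfl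

/-- The pairing of `ℓ¹` with a bounded sequence. -/
noncomputable def L1.pair (g : ℕ → ℝ) (C : ℝ) (hg : ∀ i, |g i| ≤ C) : L1 →L[ℝ] ℝ :=
  L1.lift g C hg

lemma L1.hasSum_pair (g : ℕ → ℝ) (C : ℝ) (hg : ∀ i, |g i| ≤ C) (x : L1) :
    HasSum (fun i => x i * g i) (L1.pair g C hg x) :=
  L1.hasSum_lift g C hg x

lemma L1.pair_unitVec (g : ℕ → ℝ) (C : ℝ) (hg : ∀ i, |g i| ≤ C) (i : ℕ) :
    L1.pair g C hg (unitVec i) = g i := L1.lift_unitVec g C hg i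

/-- The total mass of a summable sequence. -/
noncomputable def L1.mass : L1 →L[ℝ] ℝ := L1.pair (fun _ => 1) 1 (fun _ => by simp)

lemma L1.hasSum_mass (x : L1) : HasSum (fun i => x i) (L1.mass x) := by
  refine (L1.hasSum_pair (fun _ => 1) 1 (fun _ => by simp) x).congr_fun fun i => ?_
  rw [mul_one]

lemma L1.mass_unitVec (i : ℕ) : L1.mass (unitVec i) = 1 := L1.pair_unitVec _ _ _ i

/-! ### Bounded conservative q-matrices as operators on ℓ¹ -/

/-- A conservative `q`-matrix whose rates are bounded by `Λ`. -/
structure IsBoundedQ (Q : ℕ → ℕ → ℝ) (Λ : ℝ) : Prop where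
  pos : 0 < Λ
  off_nonneg : ∀ i j, j ≠ i → 0 ≤ Q i j
  hasSum_row : ∀ i, HasSum (Q i) 0
  le_diag : ∀ i, -Λ ≤ Q i i

namespace IsBoundedQ

variable {Q : ℕ → ℕ → ℝ} {Λ : ℝ}

lemma diag_nonpos (hQ : IsBoundedQ Q Λ) (i : ℕ) : Q i i ≤ 0 := by
  by_contra hc
  push Not at hc
  have h0 : ∀ j, 0 ≤ Q i j := fun j => by
    by_cases hj : j = i
    · exact hj ▸ hc.le
    · exact hQ.off_nonneg i j hj
  have := (hasSum_zero_iff_of_nonneg h0).1 (hQ.hasSum_row i)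
  simp [this] at hc

/-- The off-diagonal part of a row. -/
lemma hasSum_off (hQ : IsBoundedQ Q Λ) (i : ℕ) :
    HasSum (fun j => if j = i then 0 else Q i j) (-Q i i) := by
  have h := (hQ.hasSum_row i).sub (hasSum_ite_eq i (Q i i))
  rw [zero_sub] at h
  refine h.congr_fun fun j => ?_
  by_cases hj : j = i <;> simp [hj]

lemma hasSum_abs_row (hQ : IsBoundedQ Q Λ) (i : ℕ) :
    HasSum (fun j => |Q i j|) (2 * -Q i i) := by
  have h := (hQ.hasSum_off i).add (hasSum_ite_eq i (-Q i i))
  rw [← two_mul] at h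
  refine h.congr_fun fun j => ?_
  by_cases hj : j = i
  · subst hj; simp [abs_of_nonpos (hQ.diag_nonpos j)]
  · simp [hj, abs_of_nonneg (hQ.off_nonneg i j hj)]

/-- The rows of a `q`-matrix as elements of `ℓ¹`. -/
noncomputable def row (hQ : IsBoundedQ Q Λ) (i : ℕ) : L1 :=
  L1.mk (Q i) (hQ.hasSum_abs_row i).summable

lemma norm_row_le (hQ : IsBoundedQ Q Λ) (i : ℕ) : ‖hQ.row i‖ ≤ 2 * Λ := by
  rw [((hQ.row i).hasSum_abs).unique (hQ.hasSum_abs_row i)]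
  linarith [hQ.le_diag i]

/-- The operator `x ↦ x Q` on `ℓ¹`. -/
noncomputable def gen (hQ : IsBoundedQ Q Λ) : L1 →L[ℝ] L1 := L1.lift hQ.row (2 * Λ) hQ.norm_row_le

lemma gen_unitVec (hQ : IsBoundedQ Q Λ) (i : ℕ) : hQ.gen (unitVec i) = hQ.row i :=
  L1.lift_unitVec _ _ _ i

lemma gen_unitVec_apply (hQ : IsBoundedQ Q Λ) (i j : ℕ) : (hQ.gen (unitVec i)) j = Q i j := by
  rw [gen_unitVec]; rfl

lemma hasSum_gen (hQ : IsBoundedQ Q Λ) (x : L1) (j : ℕ) :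
    HasSum (fun i => x i * Q i j) ((hQ.gen x) j) := by
  have h := (L1.hasSum_map hQ.gen x).mapL (L1.coord j)
  refine h.congr_fun fun i => ?_
  rw [map_smul, L1.coord_apply, gen_unitVec_apply, smul_eq_mul]

lemma mass_gen (hQ : IsBoundedQ Q Λ) (x : L1) : L1.mass (hQ.gen x) = 0 := by
  have h := L1.hasSum_map (L1.mass ∘L hQ.gen) x
  refine h.unique ?_
  refine hasSum_zero.congr_fun fun i => ?_
  have : L1.mass (hQ.gen (unitVec i)) = 0 := by
    refine (L1.hasSum_mass _).unique ?_
    simpa only [gen_unitVec_apply] using hQ.hasSum_row i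
  simp [this]

/-- Associativity ⟨xQ, g⟩ = ⟨x, Qg⟩ for bounded g. It serves for truncated Lyapunov functions and
for the powers s^j. -/
lemma hasSum_pair_gen (hQ : IsBoundedQ Q Λ) (g G : ℕ → ℝ) (C : ℝ) (hg : ∀ i, |g i| ≤ C)
    (hG : ∀ i, HasSum (fun j => Q i j * g j) (G i)) (x : L1) :
    HasSum (fun i => x i * G i) (L1.pair g C hg (hQ.gen x)) := by
  have h := L1.hasSum_map (L1.pair g C hg ∘L hQ.gen) x
  refine h.congr_fun fun i => ?_
  have : L1.pair g C hg (hQ.gen (unitVec i)) = G i := by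
    refine (L1.hasSum_pair _ _ _ _).unique ?_
    simpa only [gen_unitVec_apply] using hG i
  simp [this]

end IsBoundedQ
-- Q-functions: backward equation and uniqueness
/-- Scheffé's lemma for series. -/
lemma tendsto_tsum_abs_sub {ι : Type*} {l : Filter ι} {a : ι → ℕ → ℝ}
    {a₀ : ℕ → ℝ} {A : ι → ℝ} {s : ℝ} (ha : ∀ᶠ n in l, ∀ k, 0 ≤ a n k)
    (hs : ∀ᶠ n in l, Summable (a n) ∧ ∑' k, a n k ≤ A n) (h0 : ∀ k, 0 ≤ a₀ k)
    (hs0 : HasSum a₀ s) (hA : Tendsto A l (𝓝 s))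
    (hlim : ∀ k, Tendsto (fun n => a n k) l (𝓝 (a₀ k))) :
    Tendsto (fun n => ∑' k, |a n k - a₀ k|) l (𝓝 0) := by
  have h1 : Tendsto (fun n => ∑' k, max (a₀ k - a n k) 0) l (𝓝 (∑' _ : ℕ, (0 : ℝ))) := by
    refine tendsto_tsum_of_dominated_convergence hs0.summable (fun k => ?_) ?_
    · have := ((hlim k).const_sub (a₀ k)).max (tendsto_const_nhds (x := (0 : ℝ)))
      simpa using this
    · filter_upwards [ha] with n hn k
      rw [Real.norm_eq_abs, abs_of_nonneg (le_max_right _ _)]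
      exact max_le (by linarith [hn k]) (h0 k)
  have h2 : Tendsto (fun n => A n - s + 2 * ∑' k, max (a₀ k - a n k) 0) l (𝓝 0) := by
    have := (hA.sub_const s).add (h1.const_mul 2)
    simpa using this
  refine squeeze_zero' (Eventually.of_forall fun n => tsum_nonneg fun k => abs_nonneg _) ?_ h2
  filter_upwards [ha, hs] with n hn hsn
  have h3 : Summable fun k => max (a₀ k - a n k) 0 :=
    Summable.of_nonneg_of_le (fun k => le_max_right _ _)
      (fun k => max_le (by linarith [hn k]) (h0 k)) hs0.summable
  have h4 : HasSum (fun k => |a n k - a₀ k|)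
      (∑' k, a n k - s + 2 * ∑' k, max (a₀ k - a n k) 0) := by
    -- This is |x| = x + 2 max(-x, 0) with x = a n k - a₀ k.
    refine ((hsn.1.hasSum.sub hs0).add (h3.hasSum.mul_left 2)).congr_fun fun k => ?_
    rcases le_total (a n k) (a₀ k) with h | h
    · rw [abs_of_nonpos (by linarith), max_eq_left (by linarith)]; ring
    · rw [abs_of_nonneg (by linarith), max_eq_right (by linarith)]; ring
  rw [h4.tsum_eq]
  linarith [hsn.2]

namespace IsQFunction

variable {Q : ℕ → ℕ → ℝ} {P : ℝ → ℕ → ℕ → ℝ}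

lemma sum_le_one (hP : IsQFunction Q P) {t : ℝ} (ht : 0 ≤ t) (i : ℕ) (s : Finset ℕ) :
    ∑ j ∈ s, P t i j ≤ 1 :=
  ((hP.row_summable t ht i).sum_le_tsum s fun j _ => hP.nonneg t ht i j).trans
    (hP.row_le_one t ht i)

lemma le_one (hP : IsQFunction Q P) {t : ℝ} (ht : 0 ≤ t) (i j : ℕ) : P t i j ≤ 1 := by
  simpa using hP.sum_le_one ht i {j}

/-- The off-diagonal part of a row of a transition function. -/
lemma off_summable (hP : IsQFunction Q P) {t : ℝ} (ht : 0 ≤ t) (i : ℕ) :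
    Summable (fun k => if k = i then 0 else P t i k) ∧
      ∑' k, (if k = i then 0 else P t i k) ≤ 1 - P t i i := by
  have h := (hP.row_summable t ht i).hasSum.sub (hasSum_ite_eq i (P t i i))
  have h' : HasSum (fun k => if k = i then 0 else P t i k) (∑' k, P t i k - P t i i) := by
    refine h.congr_fun fun k => ?_
    by_cases hk : k = i <;> simp [hk]
  refine ⟨h'.summable, ?_⟩
  rw [h'.tsum_eq]
  linarith [hP.row_le_one t ht i]

lemma hasSum_sub_diag (hP : IsQFunction Q P) {t : ℝ} (ht : 0 ≤ t) (i : ℕ) :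
    Summable (fun k => |P t i k - if i = k then 1 else 0|) ∧
    ∑' k, |P t i k - if i = k then 1 else 0| ≤ 2 * (1 - P t i i) := by
  obtain ⟨h1, h2⟩ := hP.off_summable ht i
  have h := h1.hasSum.add (hasSum_ite_eq i (1 - P t i i))
  have h' : HasSum (fun k => |P t i k - if i = k then 1 else 0|)
      (∑' k, (if k = i then 0 else P t i k) + (1 - P t i i)) := by
    refine h.congr_fun fun k => ?_
    by_cases hk : k = i
    · subst hk
      simp [abs_of_nonpos (sub_nonpos.2 (hP.le_one ht k k))]
    · simp [hk, Ne.symm hk, abs_of_nonneg (hP.nonneg t ht i k)]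
  refine ⟨h'.summable, ?_⟩
  rw [h'.tsum_eq]
  linarith

lemma hasSum_increment (hP : IsQFunction Q P) {s t : ℝ} (hs : 0 ≤ s) (ht : 0 ≤ t) (i j : ℕ) :
    HasSum (fun k => (P s i k - if i = k then 1 else 0) * P t k j) (P (s + t) i j - P t i j) := by
  refine ((hP.chapman_kolmogorov s t hs ht i j).sub (hasSum_ite_eq i (P t i j))).congr_fun
    fun k => ?_
  by_cases hk : k = i
  · subst hk; simp [sub_mul]
  · simp [hk, Ne.symm hk]

lemma abs_increment_le (hP : IsQFunction Q P) {s t : ℝ} (hs : 0 ≤ s) (ht : 0 ≤ t) (i j : ℕ) :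
    |P (s + t) i j - P t i j| ≤ 2 * (1 - P s i i) := by
  obtain ⟨h1, h2⟩ := hP.hasSum_sub_diag hs i
  refine le_trans ?_ h2
  rw [← (hP.hasSum_increment hs ht i j).tsum_eq]
  rw [← Real.norm_eq_abs]
  refine tsum_of_norm_bounded h1.hasSum fun k => ?_
  rw [norm_mul, Real.norm_eq_abs, Real.norm_eq_abs, abs_of_nonneg (hP.nonneg t ht k j)]
  exact mul_le_of_le_one_right (abs_nonneg _) (hP.le_one ht k j)

/-- An increment over a step of length u is at most 2(1 - p_ii(u)), wherever the step starts, and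
this tends to 0 with u. -/
lemma continuousOn (hP : IsQFunction Q P) (i j : ℕ) :
    ContinuousOn (fun t => P t i j) (Ici 0) := by
  have h0 : Tendsto (fun s => 2 * (1 - P s i i)) (𝓝[≥] 0) (𝓝 0) := by
    have := (hP.deriv_zero i i).continuousWithinAt.tendsto
    simpa [hP.zero] using (this.const_sub 1).const_mul 2
  intro t ht
  have hb : ∀ u ∈ Ici (0 : ℝ), |P u i j - P t i j| ≤ 2 * (1 - P |u - t| i i) := by
    intro u hu
    rcases le_total t u with h | h
    · have := hP.abs_increment_le (sub_nonneg.2 h) ht i j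
      rwa [sub_add_cancel, ← abs_of_nonneg (sub_nonneg.2 h)] at this
    · have := hP.abs_increment_le (sub_nonneg.2 h) hu i j
      rwa [sub_add_cancel, ← abs_of_nonneg (sub_nonneg.2 h), abs_sub_comm,
        abs_sub_comm t] at this
  have hlim : Tendsto (fun u => |u - t|) (𝓝[Ici 0] t) (𝓝[≥] 0) := by
    refine tendsto_nhdsWithin_iff.2 ⟨?_, Eventually.of_forall fun u => mem_Ici.2 (abs_nonneg _)⟩
    have : Tendsto (fun u => |u - t|) (𝓝 t) (𝓝 0) := by
      have : Continuous fun u : ℝ => |u - t| := by fun_prop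
      simpa using this.tendsto t
    exact this.mono_left nhdsWithin_le_nhds
  rw [ContinuousWithinAt, tendsto_iff_norm_sub_tendsto_zero]
  refine squeeze_zero' (Eventually.of_forall fun _ => norm_nonneg _) ?_
    (h0.comp hlim)
  filter_upwards [self_mem_nhdsWithin] with u hu
  exact hb u hu

/-- The difference quotients at `0` of a row of a `Q`-function converge in `ℓ¹`. -/
lemma tendsto_row_slope {Λ : ℝ} (hQ : IsBoundedQ Q Λ) (hP : IsQFunction Q P) (i : ℕ) :
    Tendsto (fun s => ∑' k, |s⁻¹ * (P s i k - if i = k then 1 else 0) - Q i k|) (𝓝[>] 0)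
      (𝓝 0) := by
  have hd : ∀ k, Tendsto (fun s => s⁻¹ * (P s i k - if i = k then 1 else 0)) (𝓝[>] 0)
      (𝓝 (Q i k)) := fun k => by
    have := (hasDerivWithinAt_iff_tendsto_slope' (self_notMem_Ioi)).1
      ((hP.deriv_zero i k).Ioi_of_Ici)
    refine this.congr fun s => ?_
    rw [slope_def_field, hP.zero, sub_zero, div_eq_inv_mul]
  have hdiag := (hd i)
  simp only [if_true] at hdiag
  have hoff : Tendsto (fun s => ∑' k, |(if k = i then 0 else s⁻¹ * P s i k) -
      (if k = i then 0 else Q i k)|) (𝓝[>] 0) (𝓝 0) := by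
    -- The off-diagonal mass is at most s⁻¹(1 - p_ii(s)), which tends to -q_ii. Conservativity makes
    -- this the full off-diagonal mass of the limit row, so Scheffé applies.
    refine tendsto_tsum_abs_sub (A := fun s => s⁻¹ * (1 - P s i i)) (s := -Q i i) ?_ ?_ ?_
      (hQ.hasSum_off i) ?_ ?_
    · filter_upwards [self_mem_nhdsWithin] with s (hs : 0 < s) k
      split_ifs
      · exact le_rfl
      · exact mul_nonneg (inv_nonneg.2 hs.le) (hP.nonneg s hs.le i k)
    · filter_upwards [self_mem_nhdsWithin] with s (hs : 0 < s)
      obtain ⟨h1, h2⟩ := hP.off_summable hs.le i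
      have h3 : HasSum (fun k => if k = i then 0 else s⁻¹ * P s i k)
          (s⁻¹ * ∑' k, (if k = i then 0 else P s i k)) := by
        refine (h1.hasSum.mul_left s⁻¹).congr_fun fun k => ?_
        rw [mul_ite, mul_zero]
      refine ⟨h3.summable, ?_⟩
      rw [h3.tsum_eq]
      exact mul_le_mul_of_nonneg_left h2 (inv_nonneg.2 hs.le)
    · intro k
      split_ifs with hk
      · exact le_rfl
      · exact hQ.off_nonneg i k hk
    · refine hdiag.neg.congr fun s => ?_
      ring
    · intro k
      by_cases hk : k = i
      · simp [hk]
      · simpa [hk, Ne.symm hk] using hd k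
  have hsum := hoff.add (tendsto_iff_norm_sub_tendsto_zero.1 hdiag)
  rw [add_zero] at hsum
  refine hsum.congr' ?_
  filter_upwards [self_mem_nhdsWithin] with s (hs : 0 < s)
  have h1 : Summable fun k => |(if k = i then 0 else s⁻¹ * P s i k) -
      (if k = i then 0 else Q i k)| := by
    refine Summable.abs (Summable.sub ?_ (hQ.hasSum_off i).summable)
    refine ((hP.off_summable hs.le i).1.mul_left s⁻¹).congr fun k => ?_
    rw [mul_ite, mul_zero]
  have h2 := h1.hasSum.add (hasSum_ite_eq i ‖s⁻¹ * (P s i i - 1) - Q i i‖)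
  rw [← h2.tsum_eq]
  refine tsum_congr fun k => ?_
  by_cases hk : k = i
  · subst hk; simp
  · simp [hk, Ne.symm hk]

/-- Kolmogorov's backward equation. -/
lemma hasDerivWithinAt {Λ : ℝ} (hQ : IsBoundedQ Q Λ) (hP : IsQFunction Q P) {t : ℝ}
    (ht : 0 ≤ t) (i j : ℕ) :
    HasDerivWithinAt (fun t => P t i j) (∑' k, Q i k * P t k j) (Ici t) t := by
  rw [← hasDerivWithinAt_Ioi_iff_Ici, hasDerivWithinAt_iff_tendsto_slope' self_notMem_Ioi,
    tendsto_iff_norm_sub_tendsto_zero]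
  have hlim : Tendsto (fun u => u - t) (𝓝[>] t) (𝓝[>] 0) := by
    refine tendsto_nhdsWithin_iff.2 ⟨?_, ?_⟩
    · have : Continuous fun u : ℝ => u - t := by fun_prop
      simpa using (this.tendsto t).mono_left nhdsWithin_le_nhds
    · filter_upwards [self_mem_nhdsWithin] with u hu
      exact mem_Ioi.2 (sub_pos.2 (mem_Ioi.1 hu))
  -- Since 0 ≤ p_kj(t) ≤ 1, the error is at most the ℓ¹ error of the difference quotient of row i at
  -- time 0.
  refine squeeze_zero' (Eventually.of_forall fun _ => norm_nonneg _) ?_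
    ((tendsto_row_slope hQ hP i).comp hlim)
  filter_upwards [self_mem_nhdsWithin] with u (hu : t < u)
  have hs : 0 ≤ u - t := (sub_pos.2 hu).le
  have hQs : Summable fun k => Q i k * P t k j := by
    refine Summable.of_norm_bounded (hQ.hasSum_abs_row i).summable fun k => ?_
    rw [norm_mul, Real.norm_eq_abs, Real.norm_eq_abs, abs_of_nonneg (hP.nonneg t ht k j)]
    exact mul_le_of_le_one_right (abs_nonneg _) (hP.le_one ht k j)
  have h1 := ((hP.hasSum_increment hs ht i j).mul_left (u - t)⁻¹).sub hQs.hasSum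
  rw [sub_add_cancel] at h1
  have h2 : slope (fun t => P t i j) t u = (u - t)⁻¹ * (P u i j - P t i j) := by
    rw [slope_def_field, div_eq_inv_mul]
  have h3 : Summable fun k =>
      |(u - t)⁻¹ * (P (u - t) i k - if i = k then 1 else 0) - Q i k| :=
    (((hP.hasSum_sub_diag hs i).1.of_abs.mul_left _).sub (hQ.hasSum_row i).summable).abs
  rw [h2, ← h1.tsum_eq]
  refine tsum_of_norm_bounded h3.hasSum fun k => ?_
  rw [← mul_assoc, ← sub_mul, norm_mul, Real.norm_eq_abs, Real.norm_eq_abs,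
    abs_of_nonneg (hP.nonneg t ht k j)]
  exact mul_le_of_le_one_right (abs_nonneg _) (hP.le_one ht k j)

/-- A bounded conservative `q`-matrix has at most one `Q`-function. -/
theorem unique {Λ : ℝ} (hQ : IsBoundedQ Q Λ) (hP : IsQFunction Q P)
    {P' : ℝ → ℕ → ℕ → ℝ} (hP' : IsQFunction Q P') {t : ℝ} (ht : 0 ≤ t) (i j : ℕ) :
    P t i j = P' t i j := by
  -- Picard iteration: the difference of two solutions vanishes at 0, and integrating the bound for
  -- n, with ∑_k |q_ik| ≤ 2Λ, gives the bound for n + 1.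
  have key : ∀ n : ℕ, ∀ i, ∀ t, 0 ≤ t →
      |P t i j - P' t i j| ≤ 2 * ((2 * Λ * t) ^ n / n.factorial) := by
    intro n
    induction n with
    | zero =>
      intro i t ht
      have h1 := hP.nonneg t ht i j
      have h2 := hP.le_one ht i j
      have h3 := hP'.nonneg t ht i j
      have h4 := hP'.le_one ht i j
      simp only [pow_zero, Nat.factorial_zero, Nat.cast_one, div_one, mul_one]
      exact abs_le.2 ⟨by linarith, by linarith⟩
    | succ n ih =>
      intro i T hT
      have hsum : ∀ {R : ℝ → ℕ → ℕ → ℝ}, IsQFunction Q R → ∀ t, 0 ≤ t →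
          Summable fun k => Q i k * R t k j := fun {R} hR t ht => by
        refine Summable.of_norm_bounded (hQ.hasSum_abs_row i).summable fun k => ?_
        rw [norm_mul, Real.norm_eq_abs, Real.norm_eq_abs, abs_of_nonneg (hR.nonneg t ht k j)]
        exact mul_le_of_le_one_right (abs_nonneg _) (hR.le_one ht k j)
      refine image_norm_le_of_norm_deriv_right_le_deriv_boundary
        (f := fun t => P t i j - P' t i j)
        (f' := fun t => ∑' k, Q i k * P t k j - ∑' k, Q i k * P' t k j)
        (B := fun t => 2 * ((2 * Λ * t) ^ (n + 1) / (n + 1).factorial))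
        (B' := fun t => 2 * Λ * (2 * ((2 * Λ * t) ^ n / n.factorial))) (a := 0) (b := T)
        (((hP.continuousOn i j).sub (hP'.continuousOn i j)).mono Icc_subset_Ici_self)
        (fun t ht => (hP.hasDerivWithinAt hQ ht.1 i j).sub (hP'.hasDerivWithinAt hQ ht.1 i j))
        ?_ ?_ ?_ ⟨hT, le_rfl⟩
      · simp [hP.zero, hP'.zero]
      · intro t
        have h := (((((hasDerivAt_id t).const_mul (2 * Λ)).pow (n + 1)).div_const
          ((n + 1).factorial : ℝ)).const_mul 2)
        refine h.congr_deriv ?_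
        rw [Nat.factorial_succ]
        push_cast
        have : (n.factorial : ℝ) ≠ 0 := by positivity
        simp only [id]
        field_simp
      · intro t ht
        rw [← (hsum hP t ht.1).tsum_sub (hsum hP' t ht.1)]
        have hB : 0 ≤ 2 * ((2 * Λ * t) ^ n / n.factorial) := (abs_nonneg _).trans (ih i t ht.1)
        refine (tsum_of_norm_bounded ((hQ.hasSum_abs_row i).mul_right _) fun k => ?_).trans
          (mul_le_mul_of_nonneg_right (?_ : 2 * -Q i i ≤ 2 * Λ) hB)
        · rw [← mul_sub, norm_mul]
          exact mul_le_mul_of_nonneg_left (ih k t ht.1) (abs_nonneg _)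
        · linarith [hQ.le_diag i]
  have hlim : Tendsto (fun n : ℕ => 2 * ((2 * Λ * t) ^ n / n.factorial)) atTop (𝓝 0) := by
    simpa using (FloorSemiring.tendsto_pow_div_factorial_atTop (2 * Λ * t)).const_mul 2
  have h0 : |P t i j - P' t i j| ≤ 0 := ge_of_tendsto' hlim fun n => key n i t ht
  exact sub_eq_zero.1 (abs_eq_zero.1 (le_antisymm h0 (abs_nonneg _)))

end IsQFunction
-- The semigroup exp(tQ), uniformization and existence
lemma L1.opNorm_le_of_unitVec (S : L1 →L[ℝ] L1) {C : ℝ} (hC : 0 ≤ C)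
    (h : ∀ i, ‖S (unitVec i)‖ ≤ C) : ‖S‖ ≤ C := by
  refine ContinuousLinearMap.opNorm_le_bound _ hC fun x => ?_
  rw [← (L1.hasSum_map S x).tsum_eq, mul_comm]
  refine tsum_of_norm_bounded (x.hasSum_abs.mul_right C) fun i => ?_
  rw [norm_smul, Real.norm_eq_abs]
  exact mul_le_mul_of_nonneg_left (h i) (abs_nonneg _)

lemma L1.norm_eq_mass {x : L1} (hx : ∀ i, 0 ≤ x i) : ‖x‖ = L1.mass x := by
  refine x.hasSum_abs.unique ((L1.hasSum_mass x).congr_fun fun i => ?_)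
  rw [abs_of_nonneg (hx i)]

namespace IsBoundedQ

variable {Q : ℕ → ℕ → ℝ} {Λ : ℝ}

/-- The operator of the uniformized jump chain. -/
noncomputable def jump (hQ : IsBoundedQ Q Λ) : L1 →L[ℝ] L1 := 1 + Λ⁻¹ • hQ.gen

lemma jump_nonneg (hQ : IsBoundedQ Q Λ) {x : L1} (hx : ∀ i, 0 ≤ x i) (j : ℕ) :
    0 ≤ (hQ.jump x) j := by
  have h : HasSum (fun i => x i * ((if i = j then 1 else 0) + Λ⁻¹ * Q i j)) ((hQ.jump x) j) := by
    have h1 := (hasSum_ite_eq j (x j)).add ((hQ.hasSum_gen x j).mul_left Λ⁻¹)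
    refine h1.congr_fun fun i => ?_
    by_cases hi : i = j
    · subst hi; simp; ring
    · simp [hi]; ring
  refine h.nonneg fun i => mul_nonneg (hx i) ?_
  by_cases hi : i = j
  · subst hi
    have := hQ.le_diag i
    have h2 : Λ⁻¹ * -Λ ≤ Λ⁻¹ * Q i i :=
      mul_le_mul_of_nonneg_left this (inv_nonneg.2 hQ.pos.le)
    rw [mul_neg, inv_mul_cancel₀ hQ.pos.ne'] at h2
    simp only [if_true]
    linarith
  · simp only [hi, if_false, zero_add]
    exact mul_nonneg (inv_nonneg.2 hQ.pos.le) (hQ.off_nonneg i j (Ne.symm hi))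

/-- The jump operator is positive and preserves mass, so each unit vector keeps norm 1. -/
lemma norm_jump_le (hQ : IsBoundedQ Q Λ) : ‖hQ.jump‖ ≤ 1 := by
  refine L1.opNorm_le_of_unitVec _ zero_le_one fun i => le_of_eq ?_
  rw [L1.norm_eq_mass (hQ.jump_nonneg fun j => ?_)]
  · have : hQ.jump (unitVec i) = unitVec i + Λ⁻¹ • hQ.gen (unitVec i) := rfl
    rw [this, map_add, map_smul, hQ.mass_gen, L1.mass_unitVec]
    simp
  · rw [unitVec_apply]; split_ifs <;> norm_num

lemma gen_eq (hQ : IsBoundedQ Q Λ) : hQ.gen = Λ • (hQ.jump - 1) := by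
  rw [jump, add_sub_cancel_left, smul_smul, mul_inv_cancel₀ hQ.pos.ne', one_smul]

/-- The transition semigroup on `ℓ¹` generated by `Q`. -/
noncomputable def semigroup (hQ : IsBoundedQ Q Λ) (t : ℝ) : L1 →L[ℝ] L1 :=
  NormedSpace.exp (t • hQ.gen)

lemma semigroup_zero (hQ : IsBoundedQ Q Λ) : hQ.semigroup 0 = 1 := by
  rw [semigroup, zero_smul, NormedSpace.exp_zero]

lemma semigroup_add (hQ : IsBoundedQ Q Λ) (s t : ℝ) :
    hQ.semigroup (s + t) = hQ.semigroup s * hQ.semigroup t := by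
  let _ : NormedAlgebra ℚ (L1 →L[ℝ] L1) := .restrictScalars ℚ ℝ _
  rw [semigroup, add_smul, NormedSpace.exp_add_of_commute]
  · rfl
  · exact ((Commute.refl hQ.gen).smul_left s).smul_right t

lemma hasDerivAt_semigroup (hQ : IsBoundedQ Q Λ) (t : ℝ) (x : L1) :
    HasDerivAt (fun u => hQ.semigroup u x) (hQ.gen (hQ.semigroup t x)) t :=
  (hasDerivAt_exp_smul_const' hQ.gen t).clm_apply (hasDerivAt_const t x) |>.congr_deriv (by
    simp [semigroup])

lemma semigroup_gen (hQ : IsBoundedQ Q Λ) (t : ℝ) (x : L1) :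
    hQ.semigroup t (hQ.gen x) = hQ.gen (hQ.semigroup t x) := by
  have h : Commute (hQ.semigroup t) hQ.gen :=
    ((Commute.refl hQ.gen).smul_left t).exp_left
  exact congrArg (fun S : L1 →L[ℝ] L1 => S x) h.eq

lemma mass_semigroup (hQ : IsBoundedQ Q Λ) (t : ℝ) (x : L1) :
    L1.mass (hQ.semigroup t x) = L1.mass x := by
  have hd : ∀ u, HasDerivAt (fun u => L1.mass (hQ.semigroup u x)) 0 u := fun u => by
    have := L1.mass.hasFDerivAt.comp_hasDerivAt u (hQ.hasDerivAt_semigroup u x)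
    rwa [hQ.mass_gen] at this
  have := is_const_of_deriv_eq_zero (fun u => (hd u).differentiableAt) (fun u => (hd u).deriv) t 0
  rw [this, hQ.semigroup_zero]; rfl

/-- Uniformization: Q = Λ(K - 1) with K the jump operator, and scalars commute with K. For t ≥ 0 the
remaining exponential is a power series in a positive operator with nonnegative coefficients, which
gives positivity. -/
lemma semigroup_eq_smul (hQ : IsBoundedQ Q Λ) (t : ℝ) :
    hQ.semigroup t = Real.exp (-(t * Λ)) • NormedSpace.exp ((t * Λ) • hQ.jump) := by
  let _ : NormedAlgebra ℚ (L1 →L[ℝ] L1) := .restrictScalars ℚ ℝ _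
  have h : t • hQ.gen = algebraMap ℝ (L1 →L[ℝ] L1) (-(t * Λ)) + (t * Λ) • hQ.jump := by
    rw [gen_eq, smul_smul, smul_sub, Algebra.algebraMap_eq_smul_one, neg_smul]
    abel
  rw [semigroup, h, NormedSpace.exp_add_of_commute (Algebra.commutes _ _),
    ← NormedSpace.algebraMap_exp_comm, Real.exp_eq_exp_ℝ, Algebra.algebraMap_eq_smul_one,
    smul_mul_assoc, one_mul]

lemma semigroup_nonneg (hQ : IsBoundedQ Q Λ) {t : ℝ} (ht : 0 ≤ t) {x : L1} (hx : ∀ i, 0 ≤ x i)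
    (j : ℕ) : 0 ≤ (hQ.semigroup t x) j := by
  have hpow : ∀ n j, 0 ≤ ((hQ.jump ^ n) x) j := by
    intro n
    induction n with
    | zero => simpa using hx
    | succ n ih =>
      intro j
      rw [pow_succ', mul_apply_eq_comp]
      exact hQ.jump_nonneg ih j
  have h1 := NormedSpace.exp_series_hasSum_exp' (𝕂 := ℝ) ((t * Λ) • hQ.jump)
  have h2 := h1.mapL ((L1.coord j).comp (ContinuousLinearMap.apply ℝ L1 x))
  have h3 : 0 ≤ (NormedSpace.exp ((t * Λ) • hQ.jump) x) j := by
    refine h2.nonneg fun n => ?_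
    have : (L1.coord j).comp (ContinuousLinearMap.apply ℝ L1 x)
        (((n.factorial : ℝ)⁻¹) • ((t * Λ) • hQ.jump) ^ n) =
        (n.factorial : ℝ)⁻¹ * ((t * Λ) ^ n * ((hQ.jump ^ n) x) j) := by
      rw [smul_pow]; rfl
    rw [this]
    have := hQ.pos.le
    have := hpow n j
    positivity
  rw [semigroup_eq_smul]
  exact mul_nonneg (Real.exp_pos _).le h3

lemma unitVec_nonneg (i j : ℕ) : 0 ≤ (unitVec i) j := by
  rw [unitVec_apply]; split_ifs <;> norm_num

/-- The `Q`-function of a bounded conservative `q`-matrix. -/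
theorem isQFunction (hQ : IsBoundedQ Q Λ) :
    IsQFunction Q fun t i j => (hQ.semigroup t (unitVec i)) j where
  nonneg t ht i j := hQ.semigroup_nonneg ht (unitVec_nonneg i) j
  row_summable t _ i := (hQ.semigroup t (unitVec i)).summable
  row_le_one t _ i := by
    rw [(L1.hasSum_mass _).tsum_eq, hQ.mass_semigroup, L1.mass_unitVec]
  zero i j := by
    rw [hQ.semigroup_zero]; exact unitVec_apply i j
  chapman_kolmogorov s t _ _ i j := by
    have h := (L1.hasSum_map (hQ.semigroup t) (hQ.semigroup s (unitVec i))).mapL (L1.coord j)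
    -- The operator at time t is applied to row i of P(s), so the composition represents t + s.
    rw [add_comm, semigroup_add]
    exact h
  deriv_zero i j := by
    have h := (L1.coord j).hasFDerivAt.comp_hasDerivAt 0 (hQ.hasDerivAt_semigroup 0 (unitVec i))
    rw [hQ.semigroup_zero, one_apply_eq_self, L1.coord_apply,
      hQ.gen_unitVec_apply] at h
    exact h.hasDerivWithinAt

lemma eq_semigroup (hQ : IsBoundedQ Q Λ) {P : ℝ → ℕ → ℕ → ℝ} (hP : IsQFunction Q P) {t : ℝ}
    (ht : 0 ≤ t) (i j : ℕ) : P t i j = (hQ.semigroup t (unitVec i)) j :=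
  hP.unique hQ hQ.isQFunction ht i j

end IsBoundedQ

/-! ### Poisson moments and asymptotic regularity -/

section Poisson

lemma hasSum_pow_div_factorial (t : ℝ) :
    HasSum (fun n : ℕ => t ^ n / n.factorial) (Real.exp t) := by
  rw [Real.exp_eq_exp_ℝ]
  exact NormedSpace.expSeries_div_hasSum_exp t

lemma hasSum_mul_pow_div_factorial (t : ℝ) :
    HasSum (fun n : ℕ => n * (t ^ n / n.factorial)) (t * Real.exp t) := by
  rw [← hasSum_nat_add_iff' 1]
  simp only [Finset.range_one, Finset.sum_singleton, Nat.cast_zero, zero_mul, sub_zero]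
  refine ((hasSum_pow_div_factorial t).mul_left t).congr_fun fun n => ?_
  rw [Nat.factorial_succ, pow_succ]
  push_cast
  field_simp

lemma hasSum_sq_mul_pow_div_factorial (t : ℝ) :
    HasSum (fun n : ℕ => (n : ℝ) ^ 2 * (t ^ n / n.factorial)) ((t ^ 2 + t) * Real.exp t) := by
  rw [← hasSum_nat_add_iff' 1]
  simp only [Finset.range_one, Finset.sum_singleton, Nat.cast_zero, zero_pow two_ne_zero,
    zero_mul, sub_zero]
  have h := ((hasSum_mul_pow_div_factorial t).add (hasSum_pow_div_factorial t)).mul_left t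
  rw [show t * (t * Real.exp t + Real.exp t) = (t ^ 2 + t) * Real.exp t by ring] at h
  refine h.congr_fun fun n => ?_
  rw [Nat.factorial_succ, pow_succ]
  push_cast
  field_simp
  ring

/-- The Poisson law of parameter t has variance t; the factor e^t is left unnormalized. -/
lemma hasSum_sq_sub_mul_pow_div_factorial (t : ℝ) :
    HasSum (fun n : ℕ => ((n : ℝ) - t) ^ 2 * (t ^ n / n.factorial)) (t * Real.exp t) := by
  have h := ((hasSum_sq_mul_pow_div_factorial t).sub
    ((hasSum_mul_pow_div_factorial t).mul_left (2 * t))).add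
    ((hasSum_pow_div_factorial t).mul_left (t ^ 2))
  rw [show (t ^ 2 + t) * Real.exp t - 2 * t * (t * Real.exp t) + t ^ 2 * Real.exp t
    = t * Real.exp t by ring] at h
  exact h.congr_fun fun n => by ring

end Poisson

/-- For a power-bounded `k`, the semigroup generated by `k - 1` is asymptotically regular. -/
lemma norm_sub_one_mul_exp_le {𝔸 : Type*} [NormedRing 𝔸] [NormOneClass 𝔸] [NormedAlgebra ℝ 𝔸]
    [CompleteSpace 𝔸] {k : 𝔸} (hk : ‖k‖ ≤ 1) {t : ℝ} (ht : 0 < t) :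
    ‖(k - 1) * NormedSpace.exp (t • k)‖ ≤ Real.exp t / √t := by
  have hexp := NormedSpace.exp_series_hasSum_exp' (𝕂 := ℝ) (t • k)
  have h1 : HasSum (fun n : ℕ => (t ^ n / n.factorial) • k ^ n) (NormedSpace.exp (t • k)) :=
    hexp.congr_fun fun n => by rw [smul_pow, smul_smul, div_eq_inv_mul]
  -- Multiplication by k shifts the index, which produces the factor n/t. Hence (k - 1) exp(tk) has
  -- coefficients (n/t - 1) t^n/n!, and its norm is at most e^t E|N/t - 1| for N Poisson of
  -- parameter t.
  have h2 : HasSum (fun n : ℕ => ((n / t) * (t ^ n / n.factorial)) • k ^ n)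
      (k * NormedSpace.exp (t • k)) := by
    rw [← hasSum_nat_add_iff' 1]
    simp only [Finset.range_one, Finset.sum_singleton, Nat.cast_zero, zero_mul, zero_div,
      zero_smul, sub_zero]
    refine (h1.mul_left k).congr_fun fun n => ?_
    rw [mul_smul_comm, ← pow_succ']
    congr 1
    rw [Nat.factorial_succ, pow_succ]
    push_cast
    field_simp
  have h3 : HasSum (fun n : ℕ => ((n / t - 1) * (t ^ n / n.factorial)) • k ^ n)
      ((k - 1) * NormedSpace.exp (t • k)) := by
    rw [sub_mul, one_mul]
    exact (h2.sub h1).congr_fun fun n => by rw [← sub_smul, sub_mul, one_mul]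
  -- The majorant is 2√t |n - t| ≤ t + (n - t)² divided by 2t√t; the variance then sums it.
  have h4 : HasSum (fun n : ℕ => (1 / (2 * √t)) * (t ^ n / n.factorial) +
      1 / (2 * t * √t) * (((n : ℝ) - t) ^ 2 * (t ^ n / n.factorial))) (Real.exp t / √t) := by
    have h := ((hasSum_pow_div_factorial t).mul_left (1 / (2 * √t))).add
      ((hasSum_sq_sub_mul_pow_div_factorial t).mul_left (1 / (2 * t * √t)))
    have hst : √t ≠ 0 := (Real.sqrt_pos.2 ht).ne'
    rw [show 1 / (2 * √t) * Real.exp t + 1 / (2 * t * √t) * (t * Real.exp t) = Real.exp t / √t by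
      field_simp; ring] at h
    exact h
  rw [← h3.tsum_eq]
  refine tsum_of_norm_bounded h4 fun n => ?_
  have hst : 0 < √t := Real.sqrt_pos.2 ht
  have hsq : √t ^ 2 = t := Real.sq_sqrt ht.le
  have hp : 0 ≤ t ^ n / n.factorial := by positivity
  have hkn : ‖k ^ n‖ ≤ 1 := (norm_pow_le k n).trans (pow_le_one₀ (norm_nonneg _) hk)
  rw [norm_smul, norm_mul, Real.norm_of_nonneg hp, Real.norm_eq_abs]
  refine (mul_le_of_le_one_right (by positivity) hkn).trans ?_
  have key : |(n : ℝ) / t - 1| ≤ 1 / (2 * √t) + 1 / (2 * t * √t) * ((n : ℝ) - t) ^ 2 := by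
    have e1 : 1 / (2 * √t) + 1 / (2 * t * √t) * ((n : ℝ) - t) ^ 2 =
        (√t ^ 2 + |(n : ℝ) - t| ^ 2) / (2 * √t * t) := by
      rw [sq_abs, hsq]; field_simp
    have e2 : |(n : ℝ) / t - 1| = (2 * √t * |(n : ℝ) - t|) / (2 * √t * t) := by
      rw [show (n : ℝ) / t - 1 = ((n : ℝ) - t) / t by field_simp, abs_div, abs_of_pos ht]
      field_simp
    rw [e1, e2]
    refine div_le_div_of_nonneg_right ?_ (by positivity)
    nlinarith [sq_nonneg (√t - |(n : ℝ) - t|)]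
  calc _ ≤ _ := mul_le_mul_of_nonneg_right key hp
    _ = _ := by ring

instance : Nontrivial L1 :=
  ⟨⟨unitVec 0, 0, fun h => by
    have := congrArg (fun x : L1 => x 0) h
    simp at this⟩⟩

/-- By uniformization the norm of Q exp(tQ) is at most Λ/√(tΛ). Initial vectors differing by an
element of the range of Q therefore become indistinguishable. -/
lemma IsBoundedQ.tendsto_semigroup_gen {Q : ℕ → ℕ → ℝ} {Λ : ℝ} (hQ : IsBoundedQ Q Λ) (x : L1) :
    Tendsto (fun t => hQ.semigroup t (hQ.gen x)) atTop (𝓝 0) := by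
  have hΛ := hQ.pos
  have h0 : Tendsto (fun t : ℝ => Λ * (1 / √(t * Λ)) * ‖x‖) atTop (𝓝 0) := by
    have : Tendsto (fun t : ℝ => √(t * Λ)) atTop atTop :=
      Real.tendsto_sqrt_atTop.comp (tendsto_id.atTop_mul_const hΛ)
    have := this.inv_tendsto_atTop
    simpa using (this.const_mul Λ).mul_const ‖x‖
  refine squeeze_zero_norm' ?_ h0
  filter_upwards [eventually_gt_atTop 0] with t ht
  rw [semigroup_gen]
  have h1 : ‖hQ.gen * hQ.semigroup t‖ ≤ Λ * (1 / √(t * Λ)) := by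
    rw [gen_eq, semigroup_eq_smul, smul_mul_smul_comm, norm_smul, norm_mul,
      Real.norm_of_nonneg hΛ.le, Real.norm_of_nonneg (Real.exp_pos _).le, mul_assoc]
    refine mul_le_mul_of_nonneg_left ?_ hΛ.le
    refine (mul_le_mul_of_nonneg_left
      (norm_sub_one_mul_exp_le hQ.norm_jump_le (mul_pos ht hΛ)) (Real.exp_pos _).le).trans
      (le_of_eq ?_)
    rw [← mul_div_assoc, ← Real.exp_add, neg_add_cancel, Real.exp_zero]
  exact ((hQ.gen * hQ.semigroup t).le_opNorm x).trans
    (mul_le_mul_of_nonneg_right h1 (norm_nonneg _))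

/-! ### The queue matrices, and B_c and H near s = 1 -/

lemma sum_range_pow_le {s : ℝ} (hs : s ∈ Icc (-1 : ℝ) 1) (n : ℕ) :
    |∑ i ∈ Finset.range n, s ^ i| ≤ n := by
  refine (Finset.abs_sum_le_sum_abs _ _).trans ?_
  refine (Finset.sum_le_card_nsmul _ _ 1 fun i _ => ?_).trans (by simp)
  rw [abs_pow]
  exact pow_le_one₀ (abs_nonneg _) (abs_le.2 hs)

namespace IsQueueData

variable {c : ℕ} {b h : ℕ → ℝ}

lemma hasSum_b (hd : IsQueueData c b h) : HasSum b 0 := by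
  have := hd.b_hasSum.add (hasSum_ite_eq 1 (b 1))
  rw [neg_add_cancel] at this
  refine this.congr_fun fun j => ?_
  by_cases hj : j = 1 <;> simp [hj]

lemma summable_abs_b (hd : IsQueueData c b h) : Summable fun j => |b j| :=
  hd.hasSum_b.summable.abs

lemma one_le_c' (hd : IsQueueData c b h) : (1 : ℝ) ≤ c := by exact_mod_cast hd.one_le_c

lemma one_le_min (hd : IsQueueData c b h) (m : ℕ) : (1 : ℝ) ≤ (min (m + 1) c : ℕ) := by
  have := hd.one_le_c
  exact_mod_cast (le_min (by omega) this : 1 ≤ min (m + 1) c)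

/-- Row m + 1 of Q* is the sequence b shifted by m, corrected at m and m + 1 for the min(m + 1, c) -
1 additional busy servers. -/
lemma hasSum_QStar_mul (m : ℕ) {g : ℕ → ℝ} {a : ℝ}
    (hg : HasSum (fun n => b n * g (n + m)) a) :
    HasSum (fun j => QStar c b (m + 1) j * g j)
      (a + (((min (m + 1) c : ℕ) : ℝ) - 1) * b 0 * (g m - g (m + 1))) := by
  rw [← hasSum_nat_add_iff' m]
  have h0 : ∑ j ∈ Finset.range m, QStar c b (m + 1) j * g j = 0 := by
    refine Finset.sum_eq_zero fun j hj => ?_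
    have := Finset.mem_range.1 hj
    rw [QStar, if_neg (by omega), if_neg (by omega), if_neg (by omega), if_neg (by omega), zero_mul]
  rw [h0, sub_zero]
  set M : ℝ := ((min (m + 1) c : ℕ) : ℝ)
  have h1 := (hg.add (hasSum_ite_eq 0 ((M - 1) * b 0 * g m))).add
    (hasSum_ite_eq 1 (-((M - 1) * b 0 * g (m + 1))))
  rw [show a + (M - 1) * b 0 * (g m - g (m + 1)) =
    a + (M - 1) * b 0 * g m + -((M - 1) * b 0 * g (m + 1)) by ring]
  refine h1.congr_fun fun n => ?_
  rw [QStar, if_neg (by omega)]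
  rcases n with _ | _ | n
  · simp [M]; ring
  · rw [if_neg (by omega), if_pos (by omega)]
    simp only [zero_add, one_ne_zero, if_false, if_true, add_comm 1 m]
    simp only [M]
    ring
  · rw [if_neg (by omega), if_neg (by omega), if_pos (by omega),
      show n + 1 + 1 + m - (m + 1) + 1 = n + 1 + 1 by omega]
    simp

lemma QStar_zero : QStar c b 0 = fun _ => 0 := by
  funext j
  simp [QStar]

lemma isBoundedQ_QStar (hd : IsQueueData c b h) : IsBoundedQ (QStar c b) (-b 1 + c * b 0) where
  pos := by
    have := hd.b_one_neg
    have := mul_nonneg (Nat.cast_nonneg (α := ℝ) c) hd.b_zero_pos.le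
    linarith
  off_nonneg i j hj := by
    have := hd.b_zero_pos
    unfold QStar
    split_ifs
    · exact le_rfl
    · positivity
    · exact hd.b_nonneg _ (by omega)
    · exact le_rfl
  hasSum_row i := by
    rcases i with _ | m
    · rw [QStar_zero]; exact hasSum_zero
    · have := hasSum_QStar_mul (c := c) (b := b) m (g := fun _ => 1) (a := 0) (by simpa using hd.hasSum_b)
      simpa using this
  le_diag i := by
    have h1 := hd.b_one_neg
    have h2 := hd.b_zero_pos
    have h3 : ((min i c : ℕ) : ℝ) ≤ c := by exact_mod_cast min_le_right i c
    have h4 := mul_nonneg (Nat.cast_nonneg (α := ℝ) c) h2.le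
    rcases eq_or_ne i 0 with rfl | hi
    · rw [QStar, if_pos rfl]; linarith
    · rw [QStar, if_neg hi, if_neg (by omega), if_pos rfl]
      nlinarith

lemma QTilde_succ (i j : ℕ) : QTilde c b h (i + 1) j = QStar c b (i + 1) j := by
  simp [QTilde, QS]

lemma QTilde_zero (j : ℕ) : QTilde c b h 0 j = if j = 0 then -hTotal h else h j := by
  simp [QTilde, QS, QStar]

lemma hTotal_nonneg (hd : IsQueueData c b h) : 0 ≤ hTotal h :=
  tsum_nonneg fun j => hd.h_nonneg _ (by omega)

lemma isBoundedQ_QTilde (hd : IsQueueData c b h) :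
    IsBoundedQ (QTilde c b h) (-b 1 + c * b 0 + hTotal h) where
  pos := add_pos_of_pos_of_nonneg hd.isBoundedQ_QStar.pos hd.hTotal_nonneg
  off_nonneg i j hj := by
    rcases i with _ | i
    · rw [QTilde_zero, if_neg hj]
      exact hd.h_nonneg j (by omega)
    · rw [QTilde_succ]
      exact hd.isBoundedQ_QStar.off_nonneg _ _ hj
  hasSum_row i := by
    rcases i with _ | i
    · rw [← hasSum_nat_add_iff' 1]
      simp only [Finset.range_one, Finset.sum_singleton, QTilde_zero, if_true, sub_neg_eq_add,
        zero_add, Nat.add_eq_zero_iff, one_ne_zero, and_false, if_false]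
      exact hd.h_summable.hasSum
    · refine (hd.isBoundedQ_QStar.hasSum_row (i + 1)).congr_fun fun j => ?_
      rw [QTilde_succ]
  le_diag i := by
    have := hd.isBoundedQ_QStar.pos
    have h2 := hd.hTotal_nonneg
    rcases i with _ | i
    · rw [QTilde_zero, if_pos rfl]; linarith
    · rw [QTilde_succ]
      linarith [hd.isBoundedQ_QStar.le_diag (i + 1)]

lemma hasSum_B (hd : IsQueueData c b h) {s : ℝ} (hs : s ∈ Icc (-1 : ℝ) 1) :
    HasSum (fun n => b n * s ^ n) (B b s) := by
  refine Summable.hasSum (Summable.of_norm_bounded hd.summable_abs_b fun n => ?_)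
  rw [norm_mul, norm_pow]
  exact mul_le_of_le_one_right (abs_nonneg _) (pow_le_one₀ (abs_nonneg _) (abs_le.2 hs))

/-- Since B(1) = 0, this is the divided difference of B at s and 1, taken termwise. -/
lemma hasSum_B_div (hd : IsQueueData c b h) {s : ℝ} (hs : s ∈ Ico (-1 : ℝ) 1) :
    HasSum (fun n => b n * ∑ i ∈ Finset.range n, s ^ i) (B b s / (s - 1)) := by
  have h1 := ((hd.hasSum_B (Ico_subset_Icc_self hs)).sub hd.hasSum_b).div_const (s - 1)
  rw [sub_zero] at h1
  refine h1.congr_fun fun n => ?_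
  rw [geom_sum_eq hs.2.ne]
  ring

lemma Bi_one (hd : IsQueueData c b h) : Bi b c 1 = 0 := by
  have : B b 1 = 0 := (hd.hasSum_B (by simp)).unique (by simpa using hd.hasSum_b)
  simp [Bi, this]

lemma Bi_div {s : ℝ} (hs : s ∈ Ico (-1 : ℝ) 1) :
    Bi b c s / (s - 1) = B b s / (s - 1) - ((c : ℝ) - 1) * b 0 := by
  have : s - 1 ≠ 0 := by linarith [hs.2]
  rw [Bi]; field_simp; ring

/-- The slopes of `B_c` at `1` converge to the derivative, if this is negative. -/
lemma tendsto_Bi_div (hd : IsQueueData c b h) (hB : BcDerivOne c b < 0) :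
    Tendsto (fun s => Bi b c s / (s - 1)) (𝓝[<] 1) (𝓝 (BcDerivOne c b)) := by
  -- The default value of the derivative is 0, so a negative value certifies differentiability.
  have h1 : HasDerivWithinAt (Bi b c) (BcDerivOne c b) (Icc (-1) 1) 1 :=
    (differentiableWithinAt_of_derivWithin_ne_zero (ne_of_lt hB)).hasDerivWithinAt
  have h2 := (hasDerivWithinAt_iff_tendsto_slope' (by simp : (1 : ℝ) ∉ Ico (-1 : ℝ) 1)).1
    (h1.mono Ico_subset_Icc_self)
  rw [nhdsWithin_Ico_eq_nhdsLT (by norm_num)] at h2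
  refine h2.congr fun s => ?_
  rw [slope_def_field, hd.Bi_one, sub_zero]

/-- The mean of the jump sizes is finite and dominated by the derivative at `1`. -/
lemma summable_mul_b (hd : IsQueueData c b h) (hB : BcDerivOne c b < 0) :
    Summable (fun n : ℕ => b n * n) ∧
      ∑' n : ℕ, b n * n ≤ BcDerivOne c b + ((c : ℝ) - 1) * b 0 := by
  have hlim : Tendsto (fun s => B b s / (s - 1)) (𝓝[<] 1)
      (𝓝 (BcDerivOne c b + ((c : ℝ) - 1) * b 0)) := by
    refine ((hd.tendsto_Bi_div hB).add_const (((c : ℝ) - 1) * b 0)).congr' ?_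
    filter_upwards [Ico_mem_nhdsLT (by norm_num : (-1 : ℝ) < 1)] with s hs
    rw [Bi_div hs, sub_add_cancel]
  have hnn : ∀ n : ℕ, 0 ≤ if n = 1 then 0 else b n * n := fun n => by
    split_ifs with hn
    · exact le_rfl
    · exact mul_nonneg (hd.b_nonneg n hn) n.cast_nonneg
  -- A Fatou argument: for s in [0, 1) the terms with n ≠ 1 are nonnegative, so finite sums are
  -- bounded by the divided difference; then s ↑ 1. The index 1, with the only negative coefficient,
  -- is split off.
  have hfin : ∀ F : Finset ℕ, ∑ n ∈ F, (if n = 1 then 0 else b n * n) ≤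
      BcDerivOne c b + ((c : ℝ) - 1) * b 0 - b 1 := by
    intro F
    have hl : Tendsto (fun s : ℝ => ∑ n ∈ F,
        (if n = 1 then 0 else b n * ∑ i ∈ Finset.range n, s ^ i)) (𝓝[<] 1)
        (𝓝 (∑ n ∈ F, (if n = 1 then 0 else b n * n))) := by
      have : Continuous fun s : ℝ => ∑ n ∈ F,
          (if n = 1 then 0 else b n * ∑ i ∈ Finset.range n, s ^ i) := by
        refine continuous_finsetSum _ fun n _ => ?_
        split_ifs <;> fun_prop
      have h2 := (this.tendsto 1).mono_left (nhdsWithin_le_nhds (s := Iio 1))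
      simpa using h2
    refine le_of_tendsto_of_tendsto hl (hlim.sub_const (b 1)) ?_
    filter_upwards [Ico_mem_nhdsLT (by norm_num : (0 : ℝ) < 1)] with s hs
    have hs' : s ∈ Ico (-1 : ℝ) 1 := ⟨by linarith [hs.1], hs.2⟩
    have h1 := (hd.hasSum_B_div hs').sub (hasSum_ite_eq 1 (b 1))
    refine (Finset.sum_le_sum fun n _ => le_of_eq ?_).trans (sum_le_hasSum F (fun n _ => ?_) h1)
    · by_cases hn : n = 1
      · subst hn; simp
      · simp [hn]
    · by_cases hn : n = 1
      · subst hn; simp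
      · simp only [hn, if_false, sub_zero]
        exact mul_nonneg (hd.b_nonneg n hn) (Finset.sum_nonneg fun i _ => pow_nonneg hs.1 i)
  have hs : Summable fun n : ℕ => if n = 1 then 0 else b n * n :=
    summable_of_sum_le hnn hfin
  have h2 : HasSum (fun n : ℕ => b n * n) (∑' n : ℕ, (if n = 1 then 0 else b n * n) + b 1) := by
    refine (hs.hasSum.add (hasSum_ite_eq 1 (b 1))).congr_fun fun n => ?_
    by_cases hn : n = 1
    · subst hn; simp
    · simp [hn]
  refine ⟨h2.summable, ?_⟩
  rw [h2.tsum_eq]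
  linarith [hs.tsum_le_of_sum_le hfin]

/-- Since |s^i| ≤ 1, the divided difference of B is at most ∑ n b_n, with equality in the term n = 1
where b_n is negative. Hence B_c(s)/(s - 1) ≤ B_c'(1) < 0. -/
lemma Bi_pos (hd : IsQueueData c b h) (hB : BcDerivOne c b < 0) {s : ℝ}
    (hs : s ∈ Ico (-1 : ℝ) 1) : 0 < Bi b c s := by
  obtain ⟨h1, h2⟩ := hd.summable_mul_b hB
  have h3 : B b s / (s - 1) ≤ ∑' n : ℕ, b n * n := by
    refine hasSum_le (fun n => ?_) (hd.hasSum_B_div hs) h1.hasSum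
    by_cases hn : n = 1
    · subst hn; simp
    · exact mul_le_mul_of_nonneg_left
        ((le_abs_self _).trans (sum_range_pow_le (Ico_subset_Icc_self hs) n)) (hd.b_nonneg n hn)
  have h4 : Bi b c s / (s - 1) < 0 := by rw [Bi_div hs]; linarith
  have h5 : s - 1 < 0 := by linarith [hs.2]
  by_contra hc
  exact absurd (div_nonneg_of_nonpos (not_lt.1 hc) h5.le) (not_le.2 h4)

lemma hasSum_H (hd : IsQueueData c b h) {s : ℝ} (hs : s ∈ Icc (-1 : ℝ) 1) :
    HasSum (fun n => h (n + 1) * s ^ (n + 1)) (H h s) := by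
  refine Summable.hasSum (Summable.of_norm_bounded hd.h_summable.abs fun n => ?_)
  rw [norm_mul, norm_pow]
  exact mul_le_of_le_one_right (abs_nonneg _) (pow_le_one₀ (abs_nonneg _) (abs_le.2 hs))

/-- Dominated convergence: the quotient is ∑ h_j (1 + ⋯ + s^{j-1}), dominated by ∑ j h_j. -/
lemma tendsto_H_div (hd : IsQueueData c b h) (hμ : MuOneFinite h) :
    Tendsto (fun s => (hTotal h - H h s) / (1 - s)) (𝓝[<] 1) (𝓝 (muOne h)) := by
  have h1 : Tendsto (fun s : ℝ => ∑' j : ℕ, h (j + 1) * ∑ i ∈ Finset.range (j + 1), s ^ i) (𝓝[<] 1)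
      (𝓝 (∑' j : ℕ, ((j : ℝ) + 1) * h (j + 1))) := by
    refine tendsto_tsum_of_dominated_convergence hμ (fun j => ?_) ?_
    · have : Continuous fun s : ℝ => h (j + 1) * ∑ i ∈ Finset.range (j + 1), s ^ i := by fun_prop
      have h2 := (this.tendsto 1).mono_left (nhdsWithin_le_nhds (s := Iio 1))
      simpa [mul_comm] using h2
    · filter_upwards [Ico_mem_nhdsLT (by norm_num : (-1 : ℝ) < 1)] with s hs j
      have := hd.h_nonneg (j + 1) (by omega)
      rw [norm_mul, Real.norm_of_nonneg this, mul_comm]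
      refine mul_le_mul_of_nonneg_right ?_ this
      have := sum_range_pow_le (Ico_subset_Icc_self hs) (j + 1)
      rw [Real.norm_eq_abs]
      exact_mod_cast this
  refine h1.congr' ?_
  filter_upwards [Ico_mem_nhdsLT (by norm_num : (-1 : ℝ) < 1)] with s hs
  refine HasSum.tsum_eq ?_
  have h2 := (hd.h_summable.hasSum.sub (hd.hasSum_H (Ico_subset_Icc_self hs))).div_const (1 - s)
  refine h2.congr_fun fun j => ?_
  have h3 : s - 1 ≠ 0 := by linarith [hs.2]
  have h4 : 1 - s ≠ 0 := by linarith [hs.2]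
  rw [geom_sum_eq hs.2.ne]
  field_simp
  ring

/-! ### Lyapunov function and negative drift -/

/-- A Lyapunov function for the stopped queue. -/
noncomputable def lyapunov (c : ℕ) (i : ℕ) : ℝ := ∑ k ∈ Finset.range i, (c : ℝ) ^ (c - (k + 1))

lemma lyapunov_succ (i : ℕ) : lyapunov c (i + 1) = lyapunov c i + (c : ℝ) ^ (c - (i + 1)) :=
  Finset.sum_range_succ _ _

lemma lyapunov_nonneg (i : ℕ) : 0 ≤ lyapunov c i := Finset.sum_nonneg fun _ _ => by positivity

lemma lyapunov_mono : Monotone (lyapunov c) :=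
  monotone_nat_of_le_succ fun i => by
    rw [lyapunov_succ]; exact le_add_of_nonneg_right (by positivity)

/-- Concavity: the slopes c^{c-(k+1)} decrease by factors c, then stay at 1 from k = c - 1 on, by
truncated subtraction. -/
lemma lyapunov_add_le (hd : IsQueueData c b h) (m n : ℕ) :
    lyapunov c (m + n) ≤ lyapunov c m + n * (c : ℝ) ^ (c - (m + 1)) := by
  induction n with
  | zero => simp
  | succ n ih =>
    rw [← add_assoc, lyapunov_succ]
    have : (c : ℝ) ^ (c - (m + n + 1)) ≤ (c : ℝ) ^ (c - (m + 1)) :=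
      pow_le_pow_right₀ hd.one_le_c' (by omega)
    push_cast
    linarith

lemma lyapunov_le (hd : IsQueueData c b h) (i : ℕ) :
    lyapunov c i ≤ i * (c : ℝ) ^ (c - 1) := by
  have := hd.lyapunov_add_le 0 i
  simpa [lyapunov] using this

lemma summable_b_mul (hd : IsQueueData c b h) {g : ℕ → ℝ} {N : ℝ} (hg : ∀ i, |g i| ≤ N) :
    Summable fun n => b n * g n := by
  refine Summable.of_norm_bounded (hd.summable_abs_b.mul_right N) fun n => ?_
  rw [norm_mul]
  exact mul_le_mul_of_nonneg_left (hg _) (abs_nonneg _)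

lemma abs_min_lyapunov_le {N : ℝ} (hN : 0 ≤ N) (i : ℕ) : |min (lyapunov c i) N| ≤ N := by
  rw [abs_of_nonneg (le_min (lyapunov_nonneg i) hN)]
  exact min_le_right _ _

/-- The truncated Lyapunov function is superharmonic, with negative drift below the truncation. -/
lemma exists_drift (hd : IsQueueData c b h) (hB : BcDerivOne c b < 0) {N : ℝ} (hN : 0 ≤ N)
    (i : ℕ) : ∃ G, HasSum (fun j => QStar c b i j * min (lyapunov c j) N) G ∧ G ≤ 0 ∧
      (1 ≤ i → lyapunov c i < N → G ≤ BcDerivOne c b) := by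
  rcases i with _ | m
  · exact ⟨0, by simp [QStar_zero], le_rfl, by simp⟩
  -- Truncation at N makes the function bounded, hence a functional on ℓ¹.
  set g : ℕ → ℝ := fun j => min (lyapunov c j) N with hg
  have hs : Summable fun n => b n * g (n + m) :=
    hd.summable_b_mul (N := N) fun n => abs_min_lyapunov_le hN _
  have hs' : HasSum (fun n => b n * (g (n + m) - g (m + 1))) (∑' n, b n * g (n + m)) := by
    have := hs.hasSum.sub (hd.hasSum_b.mul_right (g (m + 1)))
    rw [zero_mul, sub_zero] at this
    exact this.congr_fun fun n => by ring
  have hM := hd.one_le_min m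
  have hb0 := hd.b_zero_pos
  have hgm : g m ≤ g (m + 1) := min_le_min_right _ (lyapunov_mono (by omega))
  have h0 : (((min (m + 1) c : ℕ) : ℝ) - 1) * b 0 * (g m - g (m + 1)) ≤ 0 :=
    mul_nonpos_of_nonneg_of_nonpos (mul_nonneg (by linarith) hb0.le) (by linarith)
  refine ⟨_, hasSum_QStar_mul (c := c) (b := b) m hs.hasSum, ?_⟩
  rcases lt_or_ge (lyapunov c (m + 1)) N with hlt | hge
  · suffices key : ∑' n, b n * g (n + m) +
        (((min (m + 1) c : ℕ) : ℝ) - 1) * b 0 * (g m - g (m + 1)) ≤ BcDerivOne c b from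
      ⟨key.trans hB.le, fun _ _ => key⟩
    obtain ⟨hmean, hmean'⟩ := hd.summable_mul_b hB
    set δ : ℝ := (c : ℝ) ^ (c - (m + 1)) with hδ
    set δ' : ℝ := (c : ℝ) ^ (c - (m + 2)) with hδ'
    have hg1 : g (m + 1) = lyapunov c m + δ := by
      rw [hg, hδ, ← lyapunov_succ]; exact min_eq_left hlt.le
    have hg0 : g m = lyapunov c m :=
      min_eq_left ((lyapunov_mono (by omega : m ≤ m + 1)).trans hlt.le)
    -- Concavity bounds an upward jump of size n - 1 by (n - 1)δ', where δ' is the slope above m +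
    -- 1. The downward jump loses δ instead of δ', whence the correction at n = 0.
    have hup : ∑' n, b n * g (n + m) ≤
        δ' * (∑' n : ℕ, b n * n) - b 0 * (δ - δ') := by
      have h1 : HasSum (fun n : ℕ => b n * ((n - 1) * δ') + if n = 0 then -(b 0 * (δ - δ')) else 0)
          (δ' * (∑' n : ℕ, b n * n) - b 0 * (δ - δ')) := by
        have := ((hmean.hasSum.sub hd.hasSum_b).mul_left δ').add
          (hasSum_ite_eq 0 (-(b 0 * (δ - δ'))))
        rw [sub_zero, ← sub_eq_add_neg] at this
        exact this.congr_fun fun n => by ring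
      refine hasSum_le (fun n => ?_) hs' h1
      rcases n with _ | n
      · simp only [zero_add, hg1, hg0, if_true, Nat.cast_zero]
        linarith
      · simp only [Nat.add_eq_zero_iff, one_ne_zero, and_false, if_false, add_zero]
        rcases n with _ | n
        · simp [add_comm 1 m]
        · refine mul_le_mul_of_nonneg_left ?_ (hd.b_nonneg _ (by omega))
          have h2 := hd.lyapunov_add_le (m + 1) (n + 1)
          have h3 : g (n + 1 + 1 + m) ≤ lyapunov c (m + 1 + (n + 1)) := by
            rw [show n + 1 + 1 + m = m + 1 + (n + 1) by ring]
            exact min_le_left _ _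
          rw [lyapunov_succ] at h2
          push_cast at h2 ⊢
          rw [hg1]
          linarith
    have hδ'1 : 1 ≤ δ' := one_le_pow₀ hd.one_le_c'
    have hmul : δ' * (∑' n : ℕ, b n * n) ≤ δ' * (BcDerivOne c b + ((c : ℝ) - 1) * b 0) :=
      mul_le_mul_of_nonneg_left hmean' (by linarith)
    have hneg : δ' * BcDerivOne c b ≤ BcDerivOne c b := by nlinarith
    rw [hg0, hg1]
    -- The mean contributes an excess δ'(c - 1)b_0. With all c servers busy, δ = δ' = 1 and the
    -- additional service rate cancels it. With fewer, δ = cδ' and the steeper downward jump cancels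
    -- it; this dictates the ratio c of the slopes.
    rcases le_or_gt c (m + 1) with hc | hc
    · have e1 : δ = 1 := by rw [hδ, Nat.sub_eq_zero_of_le hc, pow_zero]
      have e2 : δ' = 1 := by rw [hδ', Nat.sub_eq_zero_of_le (by omega), pow_zero]
      rw [min_eq_right hc, e1]
      rw [e1, e2] at hup
      linarith
    · have e1 : δ = c * δ' := by
        rw [hδ, hδ', ← pow_succ']; congr 1; omega
      rw [e1] at hup ⊢
      have h5 : 0 ≤ (((min (m + 1) c : ℕ) : ℝ) - 1) * (b 0 * (c * δ')) := by
        have := hd.one_le_c'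
        exact mul_nonneg (by linarith) (by positivity)
      linarith
  -- At or above the truncation level g is at its maximum N, so no jump can raise it.
  · refine ⟨?_, fun _ hlt => absurd hge (not_le.2 hlt)⟩
    have hg1 : g (m + 1) = N := min_eq_right hge
    have : ∑' n, b n * g (n + m) ≤ 0 := by
      refine hs'.nonpos fun n => ?_
      by_cases hn : n = 1
      · subst hn; simp [add_comm 1 m]
      · refine mul_nonpos_of_nonneg_of_nonpos (hd.b_nonneg n hn) ?_
        rw [hg1]
        exact sub_nonpos.2 (min_le_right _ _)
    linarith

end IsQueueData
-- Occupation times of the stopped queue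
namespace IsBoundedQ

variable {Q : ℕ → ℕ → ℝ} {Λ : ℝ}

lemma continuous_semigroup (hQ : IsBoundedQ Q Λ) (x : L1) :
    Continuous fun t => hQ.semigroup t x :=
  continuous_iff_continuousAt.2 fun t => (hQ.hasDerivAt_semigroup t x).continuousAt

lemma continuous_semigroup_apply (hQ : IsBoundedQ Q Λ) (x : L1) (k : ℕ) :
    Continuous fun t => (hQ.semigroup t x) k :=
  (L1.coord k).continuous.comp (hQ.continuous_semigroup x)

end IsBoundedQ

namespace IsQueueData

variable {c : ℕ} {b h : ℕ → ℝ}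

/-- The transition probabilities of the stopped queue. -/
noncomputable def pStar (hd : IsQueueData c b h) (t : ℝ) (i k : ℕ) : ℝ :=
  (hd.isBoundedQ_QStar.semigroup t (unitVec i)) k

lemma pStar_nonneg (hd : IsQueueData c b h) {t : ℝ} (ht : 0 ≤ t) (i k : ℕ) :
    0 ≤ hd.pStar t i k :=
  hd.isBoundedQ_QStar.isQFunction.nonneg t ht i k

lemma continuous_pStar (hd : IsQueueData c b h) (i k : ℕ) :
    Continuous fun t => hd.pStar t i k :=
  hd.isBoundedQ_QStar.continuous_semigroup_apply _ k

/-- Dynkin's formula for the Lyapunov function bounds the occupation times. -/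
lemma sum_integral_pStar_le (hd : IsQueueData c b h) (hB : BcDerivOne c b < 0) (i : ℕ)
    (F : Finset ℕ) (hF : ∀ k ∈ F, 1 ≤ k) {T : ℝ} (hT : 0 ≤ T) :
    -BcDerivOne c b * ∑ k ∈ F, ∫ t in (0 : ℝ)..T, hd.pStar t i k ≤ lyapunov c i := by
  set S := hd.isBoundedQ_QStar
  -- With N above V on F, the strict drift bound holds on all of F; the other states contribute
  -- nonpositive drift.
  set N : ℝ := lyapunov c (F.sup id) + 1 with hN
  have hN0 : 0 ≤ N := add_nonneg (lyapunov_nonneg _) zero_le_one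
  have hNF : ∀ k ∈ F, lyapunov c k < N := fun k hk =>
    lt_of_le_of_lt (lyapunov_mono (Finset.le_sup (f := id) hk)) (lt_add_one _)
  choose G hG hG0 hGF using hd.exists_drift hB hN0
  set φ := L1.pair (fun j => min (lyapunov c j) N) N (abs_min_lyapunov_le hN0)
  have hder : ∀ t, HasDerivAt (fun t => φ (S.semigroup t (unitVec i)))
      (φ (S.gen (S.semigroup t (unitVec i)))) t := fun t =>
    φ.hasFDerivAt.comp_hasDerivAt t (S.hasDerivAt_semigroup t (unitVec i))
  have hcont : Continuous fun t => φ (S.gen (S.semigroup t (unitVec i))) :=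
    φ.continuous.comp (S.gen.continuous.comp (S.continuous_semigroup _))
  have hint := intervalIntegral.integral_eq_sub_of_hasDerivAt (a := 0) (b := T)
    (fun t _ => hder t) (hcont.intervalIntegrable _ _)
  have hle : ∫ t in (0 : ℝ)..T, φ (S.gen (S.semigroup t (unitVec i))) ≤
      ∫ t in (0 : ℝ)..T, BcDerivOne c b * ∑ k ∈ F, hd.pStar t i k := by
    refine intervalIntegral.integral_mono_on hT (hcont.intervalIntegrable _ _) ?_ fun t ht => ?_
    · refine Continuous.intervalIntegrable ?_ _ _
      exact continuous_const.mul (continuous_finsetSum _ fun k _ => hd.continuous_pStar i k)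
    · have hs := S.hasSum_pair_gen (fun j => min (lyapunov c j) N) G N (abs_min_lyapunov_le hN0) hG
        (S.semigroup t (unitVec i))
      refine hasSum_le (f := fun k => (S.semigroup t (unitVec i)) k * G k)
        (g := fun k => if k ∈ F then BcDerivOne c b * hd.pStar t i k else 0)
        (fun k => ?_) hs ?_
      · have hp : 0 ≤ (S.semigroup t (unitVec i)) k := hd.pStar_nonneg ht.1 i k
        dsimp only
        split_ifs with hk
        · rw [mul_comm]
          exact mul_le_mul_of_nonneg_right (hGF k (hF k hk) (hNF k hk)) hp
        · exact mul_nonpos_of_nonneg_of_nonpos hp (hG0 k)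
      · rw [Finset.mul_sum]
        have := hasSum_sum_of_ne_finset_zero (L := SummationFilter.unconditional ℕ)
          (f := fun k => if k ∈ F then BcDerivOne c b * hd.pStar t i k else 0) (s := F)
          (fun k hk => if_neg hk)
        rwa [Finset.sum_congr rfl fun k hk => if_pos hk] at this
  rw [hint, intervalIntegral.integral_const_mul, intervalIntegral.integral_finsetSum
    fun k _ => (hd.continuous_pStar i k).intervalIntegrable _ _] at hle
  have h1 : 0 ≤ φ (S.semigroup T (unitVec i)) :=
    (L1.hasSum_pair _ _ (abs_min_lyapunov_le hN0) _).nonneg fun k =>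
      mul_nonneg (hd.pStar_nonneg hT i k) (le_min (lyapunov_nonneg k) hN0)
  have h2 : φ (S.semigroup 0 (unitVec i)) ≤ lyapunov c i := by
    rw [S.semigroup_zero]
    exact (L1.pair_unitVec _ _ (abs_min_lyapunov_le hN0) i).trans_le (min_le_left _ _)
  linarith

lemma integrableOn_pStar (hd : IsQueueData c b h) (hB : BcDerivOne c b < 0) (i : ℕ) {k : ℕ}
    (hk : 1 ≤ k) : IntegrableOn (fun t => hd.pStar t i k) (Ioi 0) := by
  refine integrableOn_Ioi_of_intervalIntegral_norm_bounded (b := id) (l := atTop)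
    (lyapunov c i / -BcDerivOne c b) 0 (fun T => ?_) tendsto_id ?_
  · exact (hd.continuous_pStar i k).integrableOn_Ioc
  · filter_upwards [eventually_ge_atTop 0] with T hT
    have h1 := hd.sum_integral_pStar_le hB i {k} (by simpa using hk) hT
    rw [Finset.sum_singleton] at h1
    rw [le_div_iff₀ (neg_pos.2 hB), mul_comm]
    refine le_trans (le_of_eq ?_) h1
    congr 1
    refine intervalIntegral.integral_congr fun t ht => ?_
    rw [id, uIcc_of_le hT] at ht
    exact Real.norm_of_nonneg (hd.pStar_nonneg ht.1 i k)

lemma sum_integral_Ioi_pStar_le (hd : IsQueueData c b h) (hB : BcDerivOne c b < 0) (i : ℕ)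
    (F : Finset ℕ) (hF : ∀ k ∈ F, 1 ≤ k) :
    ∑ k ∈ F, ∫ t in Ioi (0 : ℝ), hd.pStar t i k ≤ lyapunov c i / -BcDerivOne c b := by
  have hl : Tendsto (fun T => ∑ k ∈ F, ∫ t in (0 : ℝ)..T, hd.pStar t i k) atTop
      (𝓝 (∑ k ∈ F, ∫ t in Ioi (0 : ℝ), hd.pStar t i k)) :=
    tendsto_finsetSum _ fun k hk =>
      intervalIntegral_tendsto_integral_Ioi 0 (hd.integrableOn_pStar hB i (hF k hk)) tendsto_id
  refine le_of_tendsto hl ?_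
  filter_upwards [eventually_ge_atTop 0] with T hT
  rw [le_div_iff₀ (neg_pos.2 hB), mul_comm]
  exact hd.sum_integral_pStar_le hB i F hF hT

/-- The expected time spent in the busy state `k` by the stopped queue started at `i`. -/
noncomputable def occTime (hd : IsQueueData c b h) (i k : ℕ) : ℝ :=
  if k = 0 then 0 else ∫ t in Ioi (0 : ℝ), hd.pStar t i k

lemma occTime_nonneg (hd : IsQueueData c b h) (i k : ℕ) : 0 ≤ hd.occTime i k := by
  rw [occTime]
  split_ifs
  · exact le_rfl
  · exact setIntegral_nonneg measurableSet_Ioi fun t ht => hd.pStar_nonneg (mem_Ioi.1 ht).le i k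

lemma sum_occTime_le (hd : IsQueueData c b h) (hB : BcDerivOne c b < 0) (i : ℕ) (F : Finset ℕ) :
    ∑ k ∈ F, |hd.occTime i k| ≤ lyapunov c i / -BcDerivOne c b := by
  refine le_trans (le_of_eq ?_) (hd.sum_integral_Ioi_pStar_le hB i (F.filter fun k => k ≠ 0)
    fun k hk => Nat.one_le_iff_ne_zero.2 (Finset.mem_filter.1 hk).2)
  rw [Finset.sum_filter]
  refine Finset.sum_congr rfl fun k _ => ?_
  rw [abs_of_nonneg (hd.occTime_nonneg i k), occTime]
  by_cases hk : k = 0 <;> simp [hk]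

lemma summable_occTime (hd : IsQueueData c b h) (hB : BcDerivOne c b < 0) (i : ℕ) :
    Summable fun k => |hd.occTime i k| :=
  summable_of_sum_le (fun _ => abs_nonneg _) (hd.sum_occTime_le hB i)

/-- The expected occupation times as an element of `ℓ¹`. -/
noncomputable def occ (hd : IsQueueData c b h) (hB : BcDerivOne c b < 0) (i : ℕ) : L1 :=
  L1.mk (hd.occTime i) (hd.summable_occTime hB i)

lemma norm_occ_le (hd : IsQueueData c b h) (hB : BcDerivOne c b < 0) (i : ℕ) :
    ‖hd.occ hB i‖ ≤ lyapunov c i / -BcDerivOne c b := by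
  rw [← (hd.occ hB i).hasSum_abs.tsum_eq]
  exact (hd.occ hB i).summable_abs.tsum_le_of_sum_le (hd.sum_occTime_le hB i)

/-- State 0 is absorbing, so its occupation time is replaced by 0. Row 0 of Q* vanishes, so this
does not affect the action of Q*; it also makes Q̃ act on the vector as Q* does. -/
lemma occ_zero (hd : IsQueueData c b h) (hB : BcDerivOne c b < 0) (i : ℕ) :
    (hd.occ hB i) 0 = 0 := by
  rw [occ, L1.mk_apply, occTime, if_pos rfl]

lemma occ_nonneg (hd : IsQueueData c b h) (hB : BcDerivOne c b < 0) (i k : ℕ) :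
    0 ≤ (hd.occ hB i) k := hd.occTime_nonneg i k

lemma QStar_eq_zero {i j : ℕ} (hij : j + 1 < i) : QStar c b i j = 0 := by
  rw [QStar, if_neg (by omega), if_neg (by omega), if_neg (by omega), if_neg (by omega)]

/-- Row 0 is zero and downward jumps have size one, so a column has finite support. Integrals over
time can then be exchanged with the sum. -/
lemma gen_apply (hd : IsQueueData c b h) (x : L1) (j : ℕ) :
    (hd.isBoundedQ_QStar.gen x) j = ∑ k ∈ Finset.Icc 1 (j + 1), x k * QStar c b k j := by
  refine (hd.isBoundedQ_QStar.hasSum_gen x j).unique (hasSum_sum_of_ne_finset_zero fun k hk => ?_)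
  rw [Finset.mem_Icc, not_and_or] at hk
  rcases hk with hk | hk
  · rw [show k = 0 by omega, QStar_zero, mul_zero]
  · rw [QStar_eq_zero (by omega), mul_zero]

/-- The forward equation integrated over (0, ∞): p_ij and its derivative are integrable, so p_ij(t)
→ 0 and only the initial value remains. -/
lemma gen_occ_apply (hd : IsQueueData c b h) (hB : BcDerivOne c b < 0) (i : ℕ) {j : ℕ}
    (hj : 1 ≤ j) : (hd.isBoundedQ_QStar.gen (hd.occ hB i)) j = -(unitVec i) j := by
  set S := hd.isBoundedQ_QStar
  have hder : ∀ t ∈ Ici (0 : ℝ), HasDerivAt (fun t => hd.pStar t i j)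
      (∑ k ∈ Finset.Icc 1 (j + 1), hd.pStar t i k * QStar c b k j) t := fun t _ => by
    have := (L1.coord j).hasFDerivAt.comp_hasDerivAt t (S.hasDerivAt_semigroup t (unitVec i))
    rw [L1.coord_apply, hd.gen_apply] at this
    exact this
  have hk : ∀ k ∈ Finset.Icc 1 (j + 1),
      IntegrableOn (fun t => hd.pStar t i k * QStar c b k j) (Ioi 0) := fun k hk =>
    (hd.integrableOn_pStar hB i (Finset.mem_Icc.1 hk).1).mul_const _
  have hint : IntegrableOn
      (fun t => ∑ k ∈ Finset.Icc 1 (j + 1), hd.pStar t i k * QStar c b k j) (Ioi 0) :=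
    integrable_finsetSum _ hk
  have hlim := tendsto_zero_of_hasDerivAt_of_integrableOn_Ioi
    (fun t ht => hder t (mem_Ici.2 (mem_Ioi.1 ht).le)) hint (hd.integrableOn_pStar hB i hj)
  have h1 := integral_Ioi_of_hasDerivAt_of_tendsto' hder hint hlim
  rw [integral_finsetSum _ hk, zero_sub, pStar, S.semigroup_zero] at h1
  rw [hd.gen_apply]
  refine Eq.trans (Finset.sum_congr rfl fun k hk => ?_) h1
  rw [integral_mul_const, occ, L1.mk_apply, occTime,
    if_neg (Nat.one_le_iff_ne_zero.1 (Finset.mem_Icc.1 hk).1)]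

/-- Coordinate 0 follows from the others because the generator has total mass zero; its value 1
expresses almost sure absorption at 0. -/
lemma gen_occ (hd : IsQueueData c b h) (hB : BcDerivOne c b < 0) {i : ℕ} (hi : 1 ≤ i) :
    hd.isBoundedQ_QStar.gen (hd.occ hB i) = unitVec 0 - unitVec i := by
  set y := hd.isBoundedQ_QStar.gen (hd.occ hB i) with hy
  have hj : ∀ j, 1 ≤ j → y j = -(unitVec i) j := fun j hj => hd.gen_occ_apply hB i hj
  have h0 : y 0 = 1 := by
    have h1 : HasSum (fun j => y j) 0 := by
      have := L1.hasSum_mass y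
      rwa [hy, hd.isBoundedQ_QStar.mass_gen, ← hy] at this
    have h2 : HasSum (fun j => -(unitVec i) j + if j = 0 then y 0 else 0) (-1 + y 0) := by
      have := (L1.hasSum_mass (unitVec i)).neg
      rw [L1.mass_unitVec] at this
      exact this.add (hasSum_ite_eq 0 (y 0))
    have h3 := h1.unique (h2.congr_fun fun j => ?_)
    · linarith
    · rcases Nat.eq_zero_or_pos j with rfl | hjp
      · have : (unitVec i) 0 = 0 := by rw [unitVec_apply, if_neg (by omega)]
        simp only [this, if_true, neg_zero, zero_add]
      · rw [hj j hjp, if_neg (by omega), add_zero]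
  refine L1.ext' fun j => ?_
  rw [lp.coeFn_sub, Pi.sub_apply]
  rcases Nat.eq_zero_or_pos j with rfl | hjp
  · rw [h0, unitVec_apply, unitVec_apply, if_pos rfl, if_neg (by omega), sub_zero]
  · rw [hj j hjp, unitVec_apply 0, if_neg (by omega), zero_sub]

end IsQueueData
end MXMc

/-! ### The vector r and the invariant vector -/

namespace MXMc
namespace IsQueueData

variable {c : ℕ} {b h : ℕ → ℝ}

/-- V grows at most linearly, so the norms are dominated by a multiple of i h_i, summable since μ₁ <
∞. -/
lemma summable_smul_occ (hd : IsQueueData c b h) (hB : BcDerivOne c b < 0) (hμ : MuOneFinite h) :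
    Summable fun i => h (i + 1) • hd.occ hB (i + 1) := by
  refine Summable.of_norm_bounded (hμ.mul_right ((c : ℝ) ^ (c - 1) / -BcDerivOne c b)) fun i => ?_
  have hh := hd.h_nonneg (i + 1) (by omega)
  rw [norm_smul, Real.norm_of_nonneg hh, mul_comm _ (h (i + 1)), mul_assoc]
  refine mul_le_mul_of_nonneg_left ((hd.norm_occ_le hB _).trans ?_) hh
  rw [mul_div_assoc']
  refine div_le_div_of_nonneg_right ?_ (neg_pos.2 hB).le
  exact_mod_cast hd.lyapunov_le (i + 1)

/-- The mean occupation times of the stopped queue, weighted by the resurrection rates. -/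
noncomputable def rVec (hd : IsQueueData c b h) (hB : BcDerivOne c b < 0) : L1 :=
  ∑' i, h (i + 1) • hd.occ hB (i + 1)

lemma hasSum_rVec (hd : IsQueueData c b h) (hB : BcDerivOne c b < 0) (hμ : MuOneFinite h) (k : ℕ) :
    HasSum (fun i => h (i + 1) * (hd.occ hB (i + 1)) k) ((hd.rVec hB) k) :=
  (hd.summable_smul_occ hB hμ).hasSum.mapL (L1.coord k)

lemma rVec_zero (hd : IsQueueData c b h) (hB : BcDerivOne c b < 0) (hμ : MuOneFinite h) :
    (hd.rVec hB) 0 = 0 := by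
  rw [← (hd.hasSum_rVec hB hμ 0).tsum_eq]
  simp [hd.occ_zero hB]

lemma rVec_nonneg (hd : IsQueueData c b h) (hB : BcDerivOne c b < 0) (hμ : MuOneFinite h) (k : ℕ) :
    0 ≤ (hd.rVec hB) k :=
  (hd.hasSum_rVec hB hμ k).nonneg fun i =>
    mul_nonneg (hd.h_nonneg _ (by omega)) (hd.occ_nonneg hB _ k)

lemma gen_rVec (hd : IsQueueData c b h) (hB : BcDerivOne c b < 0) (hμ : MuOneFinite h) (j : ℕ) :
    (hd.isBoundedQ_QStar.gen (hd.rVec hB)) j = if j = 0 then hTotal h else -h j := by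
  have h1 := ((hd.summable_smul_occ hB hμ).hasSum.mapL hd.isBoundedQ_QStar.gen).mapL (L1.coord j)
  refine h1.unique ?_
  have e : ∀ i, L1.coord j (hd.isBoundedQ_QStar.gen (h (i + 1) • hd.occ hB (i + 1))) =
      h (i + 1) * ((if 0 = j then 1 else 0) - if i + 1 = j then 1 else 0) := fun i => by
    rw [map_smul, hd.gen_occ hB (by omega), map_smul, smul_eq_mul, map_sub, L1.coord_apply,
      L1.coord_apply, unitVec_apply, unitVec_apply]
  simp only [e]
  rcases j with _ | j
  · simpa [hTotal] using hd.h_summable.hasSum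
  · refine (hasSum_ite_eq j (-h (j + 1))).congr_fun fun i => ?_
    by_cases hi : i = j
    · subst hi; simp
    · simp [hi]

/-- The invariant vector of the queue with resurrection, normalized to be `1` at `0`. -/
noncomputable def wVec (hd : IsQueueData c b h) (hB : BcDerivOne c b < 0) : L1 :=
  unitVec 0 + hd.rVec hB

lemma wVec_zero (hd : IsQueueData c b h) (hB : BcDerivOne c b < 0) (hμ : MuOneFinite h) :
    (hd.wVec hB) 0 = 1 := by
  rw [wVec, lp.coeFn_add, Pi.add_apply, hd.rVec_zero hB hμ, unitVec_apply, if_pos rfl, add_zero]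

lemma wVec_of_pos (hd : IsQueueData c b h) (hB : BcDerivOne c b < 0) {k : ℕ} (hk : 1 ≤ k) :
    (hd.wVec hB) k = (hd.rVec hB) k := by
  rw [wVec, lp.coeFn_add, Pi.add_apply, unitVec_apply, if_neg (by omega), zero_add]

lemma wVec_nonneg (hd : IsQueueData c b h) (hB : BcDerivOne c b < 0) (hμ : MuOneFinite h) (k : ℕ) :
    0 ≤ (hd.wVec hB) k := by
  rw [wVec, lp.coeFn_add, Pi.add_apply]
  exact add_nonneg (IsBoundedQ.unitVec_nonneg _ _) (hd.rVec_nonneg hB hμ k)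

lemma mass_wVec_pos (hd : IsQueueData c b h) (hB : BcDerivOne c b < 0) (hμ : MuOneFinite h) :
    0 < L1.mass (hd.wVec hB) := by
  have := le_hasSum (L1.hasSum_mass (hd.wVec hB)) 0 fun k _ => hd.wVec_nonneg hB hμ k
  rw [hd.wVec_zero hB hμ] at this
  linarith

lemma gen_QTilde_apply (hd : IsQueueData c b h) (x : L1) (j : ℕ) :
    (hd.isBoundedQ_QTilde.gen x) j =
      (hd.isBoundedQ_QStar.gen x) j + x 0 * (if j = 0 then -hTotal h else h j) := by
  refine (hd.isBoundedQ_QTilde.hasSum_gen x j).unique ?_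
  refine ((hd.isBoundedQ_QStar.hasSum_gen x j).add
    (hasSum_ite_eq 0 (x 0 * (if j = 0 then -hTotal h else h j)))).congr_fun fun i => ?_
  rcases i with _ | i
  · rw [QTilde_zero, QStar_zero, if_pos rfl, mul_zero, zero_add]
  · rw [QTilde_succ, if_neg (Nat.succ_ne_zero i), add_zero]

lemma gen_wVec (hd : IsQueueData c b h) (hB : BcDerivOne c b < 0) (hμ : MuOneFinite h) :
    hd.isBoundedQ_QTilde.gen (hd.wVec hB) = 0 := by
  refine L1.ext' fun j => ?_
  rw [hd.gen_QTilde_apply, hd.wVec_zero hB hμ, wVec, map_add, lp.coeFn_add, Pi.add_apply,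
    hd.isBoundedQ_QStar.gen_unitVec_apply, hd.gen_rVec hB hμ, QStar_zero]
  by_cases hj : j = 0 <;> simp [hj]

lemma semigroup_wVec (hd : IsQueueData c b h) (hB : BcDerivOne c b < 0) (hμ : MuOneFinite h)
    (t : ℝ) : hd.isBoundedQ_QTilde.semigroup t (hd.wVec hB) = hd.wVec hB := by
  set T := hd.isBoundedQ_QTilde
  have hder : ∀ u, HasDerivAt (fun u => T.semigroup u (hd.wVec hB)) 0 u := fun u => by
    have := T.hasDerivAt_semigroup u (hd.wVec hB)
    rwa [← T.semigroup_gen, hd.gen_wVec hB hμ, map_zero] at this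
  have := is_const_of_deriv_eq_zero (fun u => (hder u).differentiableAt)
    (fun u => (hder u).deriv) t 0
  rw [this, T.semigroup_zero]; rfl

/-! ### Stationarity and convergence to equilibrium -/

/-- The equilibrium distribution of the queue with resurrection. -/
noncomputable def piVec (hd : IsQueueData c b h) (hB : BcDerivOne c b < 0) : L1 :=
  (L1.mass (hd.wVec hB))⁻¹ • hd.wVec hB

lemma piVec_apply (hd : IsQueueData c b h) (hB : BcDerivOne c b < 0) (k : ℕ) :
    (hd.piVec hB) k = (L1.mass (hd.wVec hB))⁻¹ * (hd.wVec hB) k := rfl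

lemma hasSum_piVec (hd : IsQueueData c b h) (hB : BcDerivOne c b < 0) (hμ : MuOneFinite h) :
    HasSum (fun k => (hd.piVec hB) k) 1 := by
  have := L1.hasSum_mass (hd.piVec hB)
  rwa [piVec, map_smul, smul_eq_mul, inv_mul_cancel₀ (hd.mass_wVec_pos hB hμ).ne'] at this

lemma hasSum_piVec_semigroup (hd : IsQueueData c b h) (hB : BcDerivOne c b < 0)
    (hμ : MuOneFinite h) (t : ℝ) (j : ℕ) :
    HasSum (fun i => (hd.piVec hB) i * (hd.isBoundedQ_QTilde.semigroup t (unitVec i)) j)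
      ((hd.piVec hB) j) := by
  have h1 := (L1.hasSum_map (hd.isBoundedQ_QTilde.semigroup t) (hd.piVec hB)).mapL (L1.coord j)
  have h2 : hd.isBoundedQ_QTilde.semigroup t (hd.piVec hB) = hd.piVec hB := by
    rw [piVec, map_smul, hd.semigroup_wVec hB hμ]
  rw [h2] at h1
  exact h1

/-- The vector e_0 - e_i is the image under Q̃ of the occupation times from i, so asymptotic
regularity applies. -/
lemma tendsto_semigroup_sub (hd : IsQueueData c b h) (hB : BcDerivOne c b < 0) (i j : ℕ) :
    Tendsto (fun t => (hd.isBoundedQ_QTilde.semigroup t (unitVec 0)) j -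
      (hd.isBoundedQ_QTilde.semigroup t (unitVec i)) j) atTop (𝓝 0) := by
  rcases Nat.eq_zero_or_pos i with rfl | hi
  · simp
  have hgen : hd.isBoundedQ_QTilde.gen (hd.occ hB i) = unitVec 0 - unitVec i := by
    rw [← hd.gen_occ hB hi]
    refine L1.ext' fun k => ?_
    rw [hd.gen_QTilde_apply, hd.occ_zero, zero_mul, add_zero]
  have h1 := hd.isBoundedQ_QTilde.tendsto_semigroup_gen (hd.occ hB i)
  have h2 := ((L1.coord j).continuous.tendsto 0).comp h1
  rw [map_zero] at h2
  refine h2.congr fun t => ?_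
  rw [Function.comp, hgen, map_sub, map_sub]
  rfl

/-- By stationarity, the π-average over k of p_0j(t) - p_kj(t) is p_0j(t) - π_j; it tends to 0 by
dominated convergence. -/
lemma tendsto_semigroup (hd : IsQueueData c b h) (hB : BcDerivOne c b < 0)
    (hμ : MuOneFinite h) (i j : ℕ) :
    Tendsto (fun t => (hd.isBoundedQ_QTilde.semigroup t (unitVec i)) j) atTop
      (𝓝 ((hd.piVec hB) j)) := by
  set T := hd.isBoundedQ_QTilde
  have hP := T.isQFunction
  have h1 : Tendsto (fun t => ∑' k, (hd.piVec hB) k *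
      ((T.semigroup t (unitVec 0)) j - (T.semigroup t (unitVec k)) j)) atTop
      (𝓝 (∑' _ : ℕ, (0 : ℝ))) := by
    refine tendsto_tsum_of_dominated_convergence (hd.piVec hB).summable_abs (fun k => ?_) ?_
    · simpa using (hd.tendsto_semigroup_sub hB k j).const_mul ((hd.piVec hB) k)
    · filter_upwards [eventually_ge_atTop 0] with t ht k
      rw [norm_mul]
      refine mul_le_of_le_one_right (abs_nonneg _) (abs_le.2 ⟨?_, ?_⟩)
      · linarith [hP.nonneg t ht 0 j, hP.le_one ht k j]
      · linarith [hP.nonneg t ht k j, hP.le_one ht 0 j]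
  have h2 : Tendsto (fun t => (T.semigroup t (unitVec 0)) j - (hd.piVec hB) j) atTop (𝓝 0) := by
    rw [tsum_zero] at h1
    refine h1.congr fun t => HasSum.tsum_eq ?_
    have h3 := ((hd.hasSum_piVec hB hμ).mul_right ((T.semigroup t (unitVec 0)) j)).sub
      (hd.hasSum_piVec_semigroup hB hμ t j)
    rw [one_mul] at h3
    exact h3.congr_fun fun k => mul_sub _ _ _
  have h3 := (h2.sub (hd.tendsto_semigroup_sub hB i j)).add_const ((hd.piVec hB) j)
  rw [sub_zero, zero_add] at h3
  refine h3.congr fun t => ?_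
  ring

/-! ### Generating functions and the normalizing constant -/

lemma hasSum_QTilde_mul_pow (hd : IsQueueData c b h) {s : ℝ} (hs : s ∈ Icc (-1 : ℝ) 1) (i : ℕ) :
    HasSum (fun j => QTilde c b h i j * s ^ j)
      (if i = 0 then H h s - hTotal h else s ^ (i - 1) * Bi b (min i c) s) := by
  rcases i with _ | m
  · rw [if_pos rfl, ← hasSum_nat_add_iff' 1]
    simp only [Finset.range_one, Finset.sum_singleton, QTilde_zero, if_true, pow_zero, mul_one,
      Nat.add_eq_zero_iff, one_ne_zero, and_false, if_false]
    rw [show H h s - hTotal h - -hTotal h = H h s by ring]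
    exact hd.hasSum_H hs
  · rw [if_neg (Nat.succ_ne_zero m), Nat.add_sub_cancel]
    have h1 : HasSum (fun n => b n * s ^ (n + m)) (B b s * s ^ m) :=
      ((hd.hasSum_B hs).mul_right (s ^ m)).congr_fun fun n => by ring
    have h2 := hasSum_QStar_mul (c := c) m h1
    rw [show B b s * s ^ m + (((min (m + 1) c : ℕ) : ℝ) - 1) * b 0 * (s ^ m - s ^ (m + 1)) =
      s ^ m * Bi b (min (m + 1) c) s by rw [Bi]; ring] at h2
    exact h2.congr_fun fun j => by rw [QTilde_succ]

lemma abs_pow_le_one {s : ℝ} (hs : s ∈ Icc (-1 : ℝ) 1) (j : ℕ) : |s ^ j| ≤ 1 := by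
  rw [abs_pow]
  exact pow_le_one₀ (abs_nonneg _) (abs_le.2 hs)

/-- The functional equation of the generating function of the invariant vector. -/
lemma tsum_wVec_mul_pow (hd : IsQueueData c b h) (hB : BcDerivOne c b < 0) (hμ : MuOneFinite h)
    {s : ℝ} (hs : s ∈ Icc (-1 : ℝ) 1) :
    (∑' j, (hd.wVec hB) j * s ^ j) * Bi b c s = Bi b c s + s * (hTotal h - H h s) +
      ∑ k ∈ Finset.Icc 1 (c - 1), (hd.wVec hB) k * s ^ k * ((c : ℝ) - k) * b 0 * (1 - s) := by
  -- The factor s turns the s^{i-1} of row i into s^i.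
  have h1 := (hd.isBoundedQ_QTilde.hasSum_pair_gen (fun j => s ^ j) _ 1 (abs_pow_le_one hs)
    (hd.hasSum_QTilde_mul_pow hs) (hd.wVec hB)).mul_left s
  rw [hd.gen_wVec hB hμ, map_zero, mul_zero] at h1
  have hW : HasSum (fun j => (hd.wVec hB) j * s ^ j) (∑' j, (hd.wVec hB) j * s ^ j) :=
    (L1.hasSum_pair _ 1 (abs_pow_le_one hs) _).summable.hasSum
  have hfin := hasSum_sum_of_ne_finset_zero (L := SummationFilter.unconditional ℕ)
    (f := fun k => if k ∈ Finset.Icc 1 (c - 1) then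
      (hd.wVec hB) k * s ^ k * ((c : ℝ) - k) * b 0 * (1 - s) else 0)
    (s := Finset.Icc 1 (c - 1)) (fun k hk => if_neg hk)
  rw [Finset.sum_congr rfl fun k hk => if_pos hk] at hfin
  -- For 1 ≤ i < c one has B_i = B_c - (c - i) b_0 (1 - s), which gives the finite sum; the last
  -- term replaces B_c by the contribution of row 0.
  have h2 := ((hW.mul_right (Bi b c s)).sub hfin).add
    (hasSum_ite_eq 0 (s * (H h s - hTotal h) - Bi b c s))
  have h3 := h1.unique (h2.congr_fun fun i => ?_)
  · linarith
  rcases i with _ | m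
  · rw [if_pos rfl, if_pos rfl, if_neg (by simp), hd.wVec_zero hB hμ, pow_zero]
    ring
  · rw [if_neg (Nat.succ_ne_zero m), if_neg (Nat.succ_ne_zero m), Nat.add_sub_cancel]
    by_cases hm : m + 1 ≤ c - 1
    · rw [if_pos (Finset.mem_Icc.2 ⟨by omega, hm⟩), min_eq_left (by omega), Bi, Bi, pow_succ]
      ring
    · rw [if_neg (fun hk => hm (Finset.mem_Icc.1 hk).2), min_eq_right (by omega), pow_succ]
      ring

/-- The functional equation divided by 1 - s, in the limit s ↑ 1. -/
lemma mass_wVec (hd : IsQueueData c b h) (hB : BcDerivOne c b < 0) (hμ : MuOneFinite h) :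
    -BcDerivOne c b * L1.mass (hd.wVec hB) = -BcDerivOne c b + muOne h +
      ∑ k ∈ Finset.Icc 1 (c - 1), (hd.wVec hB) k * ((c : ℝ) - k) * b 0 := by
  have hmem : ∀ᶠ s in 𝓝[<] (1 : ℝ), s ∈ Ico (-1 : ℝ) 1 := Ico_mem_nhdsLT (by norm_num)
  have hBi : Tendsto (fun s => Bi b c s / (1 - s)) (𝓝[<] 1) (𝓝 (-BcDerivOne c b)) := by
    refine (hd.tendsto_Bi_div hB).neg.congr fun s => ?_
    rw [← div_neg, neg_sub]
  have hW : Tendsto (fun s : ℝ => ∑' j, (hd.wVec hB) j * s ^ j) (𝓝[<] 1)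
      (𝓝 (L1.mass (hd.wVec hB))) := by
    rw [← (L1.hasSum_mass _).tsum_eq]
    refine tendsto_tsum_of_dominated_convergence (hd.wVec hB).summable_abs (fun k => ?_) ?_
    · have : Continuous fun s : ℝ => (hd.wVec hB) k * s ^ k := by fun_prop
      simpa using (this.tendsto 1).mono_left (nhdsWithin_le_nhds (s := Iio 1))
    · filter_upwards [hmem] with s hs k
      rw [norm_mul]
      exact mul_le_of_le_one_right (abs_nonneg _) (abs_pow_le_one (Ico_subset_Icc_self hs) k)
  have hid : Tendsto (fun s : ℝ => s) (𝓝[<] 1) (𝓝 1) := tendsto_id.mono_left nhdsWithin_le_nhds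
  have hsum : Tendsto (fun s : ℝ =>
      ∑ k ∈ Finset.Icc 1 (c - 1), (hd.wVec hB) k * s ^ k * ((c : ℝ) - k) * b 0) (𝓝[<] 1)
      (𝓝 (∑ k ∈ Finset.Icc 1 (c - 1), (hd.wVec hB) k * ((c : ℝ) - k) * b 0)) := by
    have : Continuous fun s : ℝ =>
      ∑ k ∈ Finset.Icc 1 (c - 1), (hd.wVec hB) k * s ^ k * ((c : ℝ) - k) * b 0 := by fun_prop
    simpa using (this.tendsto 1).mono_left (nhdsWithin_le_nhds (s := Iio 1))
  have hR := (hBi.add (hid.mul (hd.tendsto_H_div hμ))).add hsum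
  rw [one_mul] at hR
  refine tendsto_nhds_unique (hBi.mul hW) (hR.congr' ?_)
  filter_upwards [hmem] with s hs
  have h1 : 1 - s ≠ 0 := by linarith [hs.2]
  have h2 := hd.tsum_wVec_mul_pow hB hμ (Ico_subset_Icc_self hs)
  rw [← Finset.sum_mul] at h2
  rw [div_mul_eq_mul_div, mul_comm (Bi b c s), h2, add_div, add_div, mul_div_cancel_right₀ _ h1,
    mul_div_assoc]

/-! ### Transfer to arbitrary Q-functions -/

lemma pStar_eq (hd : IsQueueData c b h) {PStar : ℝ → ℕ → ℕ → ℝ}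
    (hP : IsQFunction (QStar c b) PStar) {t : ℝ} (ht : 0 ≤ t) (i k : ℕ) :
    PStar t i k = hd.pStar t i k := hd.isBoundedQ_QStar.eq_semigroup hP ht i k

lemma mStar_eq (hd : IsQueueData c b h) (hB : BcDerivOne c b < 0) {PStar : ℝ → ℕ → ℕ → ℝ}
    (hP : IsQFunction (QStar c b) PStar) (i : ℕ) {k : ℕ} (hk : 1 ≤ k) :
    mStar PStar k i = (hd.occ hB i) k := by
  rw [occ, L1.mk_apply, occTime, if_neg (by omega), mStar]
  exact setIntegral_congr_fun measurableSet_Ioi fun t ht => hd.pStar_eq hP (mem_Ioi.1 ht).le i k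

lemma r_eq (hd : IsQueueData c b h) (hB : BcDerivOne c b < 0) (hμ : MuOneFinite h)
    {PStar : ℝ → ℕ → ℕ → ℝ} (hP : IsQFunction (QStar c b) PStar) {k : ℕ} (hk : 1 ≤ k) :
    r h PStar k = (hd.rVec hB) k := by
  rw [r, ← (hd.hasSum_rVec hB hμ k).tsum_eq]
  exact tsum_congr fun i => by rw [hd.mStar_eq hB hP _ hk]

lemma rVec_one (hd : IsQueueData c b h) (hB : BcDerivOne c b < 0) (hμ : MuOneFinite h) :
    b 0 * (hd.rVec hB) 1 = hTotal h := by
  have h1 := hd.gen_rVec hB hμ 0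
  have hc := hd.one_le_c
  rw [hd.gen_apply, if_pos rfl, zero_add, Finset.Icc_self, Finset.sum_singleton, QStar,
    if_neg one_ne_zero, if_pos (zero_add 1), min_eq_left hc, Nat.cast_one, one_mul] at h1
  rw [← h1, mul_comm]

lemma rVec_linear (hd : IsQueueData c b h) (hB : BcDerivOne c b < 0) (hμ : MuOneFinite h)
    {j : ℕ} (hj : 1 ≤ j) :
    ∑ i ∈ Finset.Icc 1 (j - 1), b (j - i + 1) * (hd.rVec hB) i
      + (b 1 - ((min j c : ℕ) - 1) * b 0) * (hd.rVec hB) j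
      + (min (j + 1) c : ℕ) * b 0 * (hd.rVec hB) (j + 1) = -h j := by
  have h1 := hd.gen_rVec hB hμ j
  obtain ⟨n, rfl⟩ : ∃ n, j = n + 1 := ⟨j - 1, by omega⟩
  rw [hd.gen_apply, if_neg (by omega), Finset.sum_Icc_succ_top (by omega),
    Finset.sum_Icc_succ_top (by omega)] at h1
  rw [← h1, Nat.add_sub_cancel]
  refine congrArg₂ _ (congrArg₂ _ (Finset.sum_congr rfl fun i hi => ?_) ?_) ?_
  · have := Finset.mem_Icc.1 hi
    rw [QStar, if_neg (by omega), if_neg (by omega), if_neg (by omega), if_pos (by omega), mul_comm]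
  · rw [QStar, if_neg (by omega), if_neg (by omega), if_pos rfl, mul_comm]
  · rw [QStar, if_neg (by omega), if_pos rfl, mul_comm]

lemma isEquilibriumDistribution (hd : IsQueueData c b h) (hB : BcDerivOne c b < 0)
    (hμ : MuOneFinite h) {PTilde : ℝ → ℕ → ℕ → ℝ} (hP : IsQFunction (QTilde c b h) PTilde) :
    IsEquilibriumDistribution PTilde fun k => (hd.piVec hB) k where
  nonneg j := mul_nonneg (inv_nonneg.2 (hd.mass_wVec_pos hB hμ).le) (hd.wVec_nonneg hB hμ j)
  hasSum_one := hd.hasSum_piVec hB hμ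
  stationary t ht j := by
    refine (hd.hasSum_piVec_semigroup hB hμ t j).congr_fun fun i => ?_
    rw [hd.isBoundedQ_QTilde.eq_semigroup hP ht]
  tendsto i j := by
    refine (hd.tendsto_semigroup hB hμ i j).congr' ?_
    filter_upwards [eventually_ge_atTop 0] with t ht
    rw [hd.isBoundedQ_QTilde.eq_semigroup hP ht]

lemma hasSum_piVec_mul_pow (hd : IsQueueData c b h) (hB : BcDerivOne c b < 0)
    (hμ : MuOneFinite h) {s : ℝ} (hs : s ∈ Ico (-1 : ℝ) 1) :
    HasSum (fun j => (hd.piVec hB) j * s ^ j)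
      ((hd.piVec hB) 0 * (1 + s * (hTotal h - H h s) / Bi b c s) + 1 / Bi b c s *
        ∑ k ∈ Finset.Icc 1 (c - 1), (hd.piVec hB) k * s ^ k * ((c : ℝ) - k) * b 0 * (1 - s)) := by
  have hpos := hd.Bi_pos hB hs
  have hs' := Ico_subset_Icc_self hs
  have hW : HasSum (fun j => (hd.wVec hB) j * s ^ j) (∑' j, (hd.wVec hB) j * s ^ j) :=
    (L1.hasSum_pair _ 1 (abs_pow_le_one hs') _).summable.hasSum
  have h1 := hd.tsum_wVec_mul_pow hB hμ hs'
  rw [← eq_div_iff hpos.ne'] at h1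
  have h2 := hW.mul_left (L1.mass (hd.wVec hB))⁻¹
  have h3 : ∑ k ∈ Finset.Icc 1 (c - 1), (hd.piVec hB) k * s ^ k * ((c : ℝ) - k) * b 0 * (1 - s) =
      (L1.mass (hd.wVec hB))⁻¹ *
      ∑ k ∈ Finset.Icc 1 (c - 1), (hd.wVec hB) k * s ^ k * ((c : ℝ) - k) * b 0 * (1 - s) := by
    rw [Finset.mul_sum]
    exact Finset.sum_congr rfl fun k _ => by rw [piVec_apply]; ring
  rw [h3, piVec_apply, hd.wVec_zero hB hμ]
  rw [h1] at h2
  have h4 := h2.congr_fun (g := fun j => (hd.piVec hB) j * s ^ j) fun j => by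
    rw [piVec_apply, mul_assoc]
  generalize ∑ k ∈ Finset.Icc 1 (c - 1),
    (hd.wVec hB) k * s ^ k * ((c : ℝ) - k) * b 0 * (1 - s) = σ at h4 ⊢
  rw [show (L1.mass (hd.wVec hB))⁻¹ * 1 * (1 + s * (hTotal h - H h s) / Bi b c s) +
      1 / Bi b c s * ((L1.mass (hd.wVec hB))⁻¹ * σ) = (L1.mass (hd.wVec hB))⁻¹ *
      ((Bi b c s + s * (hTotal h - H h s) + σ) / Bi b c s) by
    rw [add_div, add_div, div_self hpos.ne']; ring]
  exact h4

end IsQueueData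
end MXMc

theorem theorem3p3 (c : ℕ) (b h : ℕ → ℝ) (hdata : MXMc.IsQueueData c b h)
    (hB : MXMc.BcDerivOne c b < 0) (hμ : MXMc.MuOneFinite h) :
    (∃ PStar, MXMc.IsQFunction (MXMc.QStar c b) PStar) ∧
    (∃ PTilde, MXMc.IsQFunction (MXMc.QTilde c b h) PTilde) ∧
    ∀ PStar PTilde : ℝ → ℕ → ℕ → ℝ,
      MXMc.IsQFunction (MXMc.QStar c b) PStar →
      MXMc.IsQFunction (MXMc.QTilde c b h) PTilde →
      -- the integrals and the series that define `r_k` converge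
      (∀ i k, 1 ≤ i → 1 ≤ k → IntegrableOn (fun t => PStar t i k) (Ioi 0)) ∧
      (∀ k, 1 ≤ k → Summable fun i => h (i + 1) * MXMc.mStar PStar k (i + 1)) ∧
      -- the linear equations for `r_k`
      b 0 * MXMc.r h PStar 1 = MXMc.hTotal h ∧
      (∀ j, 1 ≤ j →
        ∑ i ∈ Finset.Icc 1 (j - 1), b (j - i + 1) * MXMc.r h PStar i
          + (b 1 - ((min j c : ℕ) - 1) * b 0) * MXMc.r h PStar j
          + (min (j + 1) c : ℕ) * b 0 * MXMc.r h PStar (j + 1) = -h j) ∧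
      -- the equilibrium distribution and its generating function
      ∃ π : ℕ → ℝ, MXMc.IsEquilibriumDistribution PTilde π ∧
        π 0 = -MXMc.BcDerivOne c b *
          (-MXMc.BcDerivOne c b + MXMc.muOne h
            + ∑ k ∈ Finset.Icc 1 (c - 1), MXMc.r h PStar k * ((c : ℝ) - k) * b 0)⁻¹ ∧
        0 < -MXMc.BcDerivOne c b + MXMc.muOne h
            + ∑ k ∈ Finset.Icc 1 (c - 1), MXMc.r h PStar k * ((c : ℝ) - k) * b 0 ∧
        (∀ k, 1 ≤ k → π k = π 0 * MXMc.r h PStar k) ∧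
        ∀ s ∈ Ico (-1 : ℝ) 1, MXMc.Bi b c s ≠ 0 ∧
          HasSum (fun j => π j * s ^ j)
            (π 0 * (1 + s * (MXMc.hTotal h - MXMc.H h s) / MXMc.Bi b c s)
              + 1 / MXMc.Bi b c s *
                ∑ k ∈ Finset.Icc 1 (c - 1), π k * s ^ k * ((c : ℝ) - k) * b 0 * (1 - s)) := by
  have hT := hdata.isBoundedQ_QTilde
  refine ⟨⟨_, hdata.isBoundedQ_QStar.isQFunction⟩, ⟨_, hT.isQFunction⟩, ?_⟩
  intro PStar PTilde hPS hPT
  have hr : ∀ k, 1 ≤ k → MXMc.r h PStar k = (hdata.rVec hB) k := fun k hk =>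
    hdata.r_eq hB hμ hPS hk
  have hw : ∀ k, 1 ≤ k → MXMc.r h PStar k = (hdata.wVec hB) k := fun k hk => by
    rw [hr k hk, hdata.wVec_of_pos hB hk]
  have hmass := hdata.mass_wVec hB hμ
  have hpos := hdata.mass_wVec_pos hB hμ
  have hsum : ∑ k ∈ Finset.Icc 1 (c - 1), MXMc.r h PStar k * ((c : ℝ) - k) * b 0 =
      ∑ k ∈ Finset.Icc 1 (c - 1), (hdata.wVec hB) k * ((c : ℝ) - k) * b 0 :=
    Finset.sum_congr rfl fun k hk => by rw [hw k (Finset.mem_Icc.1 hk).1]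
  rw [← hsum] at hmass
  refine ⟨fun i k _ hk => ?_, fun k hk => ?_, ?_, fun j hj => ?_,
    fun k => (hdata.piVec hB) k, hdata.isEquilibriumDistribution hB hμ hPT, ?_, ?_,
    fun k hk => ?_, fun s hs => ⟨(hdata.Bi_pos hB hs).ne', hdata.hasSum_piVec_mul_pow hB hμ hs⟩⟩
  · exact (hdata.integrableOn_pStar hB i hk).congr_fun
      (fun t ht => (hdata.pStar_eq hPS (mem_Ioi.1 ht).le i k).symm) measurableSet_Ioi
  · refine (hdata.hasSum_rVec hB hμ k).summable.congr fun i => ?_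
    rw [hdata.mStar_eq hB hPS _ hk]
  · rw [hr 1 le_rfl, hdata.rVec_one hB hμ]
  · rw [hr j hj, hr (j + 1) (by omega), ← hdata.rVec_linear hB hμ hj,
      Finset.sum_congr rfl fun i hi => by rw [hr i (Finset.mem_Icc.1 hi).1]]
  -- The bracket is -B_c'(1) times the mass of w, so the formula reads π_0 = 1/mass.
  · rw [← hmass, mul_inv, mul_inv_cancel_left₀ (neg_pos.2 hB).ne']
    dsimp only
    rw [hdata.piVec_apply, hdata.wVec_zero hB hμ, mul_one]
  · rw [← hmass]
    exact mul_pos (neg_pos.2 hB) hpos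
  · dsimp only
    rw [hdata.piVec_apply, hdata.piVec_apply, hdata.wVec_zero hB hμ, mul_one, hw k hk]
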